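/- For a finite non-abelian group $G$ let $\Gamma_G$ be its commuting conjugacy class graph: the vertices are the conjugacy classes of the non-central elements of $G$, and two distinct classes $x^G,y^G$ are adjacent iff some $x'\in x^G$ and $y'\in y^G$ commute. For a finite graph $\mathcal G$ on vertices $v_1,\dots,v_N$ ($N \ge 1$) let $CN(\mathcal G)$ be the $N\times N$ matrix whose $(i,j)$ entry is the number of common neighbours of $v_i$ and $v_j$ if $i\ne j$, and $0$ if $i=j$; let $CNRS(\mathcal G)$ be the diagonal matrix of the row sums of $CN(\mathcal G)$, and put $\Delta=\operatorname{tr}(CNRS(\mathcal G))/N$. Let $E_{CN}(\mathcal G)=\sum|\lambda|$ over the eigenvalues $\lambda$ of $CN(\mathcal G)$, $LE_{CN}(\mathcal G)=\sum|\alpha-\Delta|$ over the eigenvalues $\alpha$ of $CNRS(\mathcal G)-CN(\mathcal G)$, and $LE^+_{CN}(\mathcal G)=\sum|\beta-\Delta|$ over the eigenvalues $\beta$ of $CNRS(\mathcal G)+CN(\mathcal G)$, all eigenvalues being counted with multiplicity. Let $G$ be one of the following groups: - $D_{2n}=\langle x,y: x^n=y^2=1,\ yxy^{-1}=x^{-1}\rangle$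 with $n\ge 3$; - $T_{4n}=\langle x,y: x^{2n}=1,\ x^n=y^2,\ y^{-1}xy=x^{-1}\rangle$ with $n\ge 2$; - $U_{6n}=\langle x,y: x^{2n}=y^3=1,\ x^{-1}yx=y^{-1}\rangle$ with $n\ge 2$; - $SD_{8n}=\langle x,y: x^{4n}=y^2=1,\ yxy=x^{2n-1}\rangle$ with $n\ge 2$; - $V_{8n}=\langle x,y: x^{2n}=y^4=1,\ yx=x^{-1}y^{-1},\ y^{-1}x=x^{-1}y\rangle$ with $n\ge 2$; - $U_{(n,m)}=\langle x,y: x^{2n}=y^m=1,\ x^{-1}yx=y^{-1}\rangle$ with $n\ge 2$ and $m\ge 3$. Then 1. $E_{CN}(\Gamma_G)=LE^+_{CN}(\Gamma_G)=LE_{CN}(\Gamma_G)$ if and only if $G$ is one of $D_6$, $D_8$, $D_{10}$, $D_{12}$, $T_8$, $T_{12}$, $SD_{24}$, $V_{16}$, $U_{6n}$ with $n\ge 2$, or $U_{(n,m)}$ with $m\in\{3,4,6\}$ and $n\ge 2$; 2. $E_{CN}(\Gamma_G)<LE^+_{CN}(\Gamma_G)<LE_{CN}(\Gamma_G)$ if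 and only if $G$ is not one of the groups listed in (1). -/

import Mathlib

/-! ### Common neighborhood matrices and energies of a finite graph -/

namespace SimpleGraph

variable {V : Type*} [Fintype V]

open scoped Classical in
/-- The common neighborhood matrix: for `i ≠ j` the entry is the number of common neighbors of
`i` and `j`, and the diagonal is zero. -/
noncomputable def cnMatrix (Γ : SimpleGraph V) : Matrix V V ℝ :=
  Matrix.of fun i j => if i = j then 0 else ((Γ.commonNeighbors i j).ncard : ℝ)

open scoped Classical in
/-- The diagonal matrix of the row sums of the common neighborhood matrix. -/
noncomputable def cnrsMatrix (Γ : SimpleGraph V) : Matrix V V ℝ :=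
  Matrix.diagonal fun i => ∑ k, Γ.cnMatrix i k

/-- The common neighborhood Laplacian matrix. -/
noncomputable def cnlMatrix (Γ : SimpleGraph V) : Matrix V V ℝ :=
  Γ.cnrsMatrix - Γ.cnMatrix

/-- The common neighborhood signless Laplacian matrix. -/
noncomputable def cnslMatrix (Γ : SimpleGraph V) : Matrix V V ℝ :=
  Γ.cnrsMatrix + Γ.cnMatrix

open scoped Classical in
/-- The sum of `|t - c|` over the eigenvalues `t` of `M`, counted with multiplicity. It is only
used for real symmetric matrices, all of whose eigenvalues are real; they are the roots of the
characteristic polynomial, with multiplicity. -/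
noncomputable def eigenvalueDeviation (M : Matrix V V ℝ) (c : ℝ) : ℝ :=
  (M.charpoly.roots.map fun t => |t - c|).sum

/-- The mean `tr (CNRS) / |V|`. -/
noncomputable def cnMean (Γ : SimpleGraph V) : ℝ :=
  Γ.cnrsMatrix.trace / (Fintype.card V : ℝ)

/-- The CN-energy `E_CN`: the sum of the absolute values of the eigenvalues of the common
neighborhood matrix. -/
noncomputable def cnEnergy (Γ : SimpleGraph V) : ℝ :=
  eigenvalueDeviation Γ.cnMatrix 0

/-- The CNL-energy `LE_CN`. -/
noncomputable def cnlEnergy (Γ : SimpleGraph V) : ℝ :=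
  eigenvalueDeviation Γ.cnlMatrix Γ.cnMean

/-- The CNSL-energy `LE⁺_CN`. -/
noncomputable def cnslEnergy (Γ : SimpleGraph V) : ℝ :=
  eigenvalueDeviation Γ.cnslMatrix Γ.cnMean

end SimpleGraph

/-! ### The commuting conjugacy class graph -/

/-- The conjugacy classes of non-central elements of `G`, that is, the conjugacy classes with more
than one element. -/
def CCCVertex (G : Type*) [Group G] : Type _ := ↥(ConjClasses.noncenter G)

noncomputable instance (G : Type*) [Group G] [Finite G] : Fintype (CCCVertex G) :=
  haveI : Finite (ConjClasses G) := inferInstanceAs (Finite (Quotient _))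
  haveI : Finite (CCCVertex G) := inferInstanceAs (Finite ↥(ConjClasses.noncenter G))
  Fintype.ofFinite _

/-- The commuting conjugacy class graph: two distinct classes are adjacent when some element of the
one commutes with some element of the other. -/
def cccGraph (G : Type*) [Group G] : SimpleGraph (CCCVertex G) where
  Adj c d := c ≠ d ∧ ∃ g ∈ c.1.carrier, ∃ h ∈ d.1.carrier, g * h = h * g
  symm := ⟨fun _ _ ⟨hne, g, hg, h, hh, e⟩ => ⟨hne.symm, h, hh, g, hg, e.symm⟩⟩
  loopless := ⟨fun _ hc => hc.1 rfl⟩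

/-- `E_CN(Γ_G) = LE⁺_CN(Γ_G) = LE_CN(Γ_G)`. -/
def CNEnergiesEqual (G : Type*) [Group G] [Finite G] : Prop :=
  (cccGraph G).cnEnergy = (cccGraph G).cnslEnergy ∧
    (cccGraph G).cnslEnergy = (cccGraph G).cnlEnergy

/-- `E_CN(Γ_G) < LE⁺_CN(Γ_G) < LE_CN(Γ_G)`. -/
def CNEnergiesIncreasing (G : Type*) [Group G] [Finite G] : Prop :=
  (cccGraph G).cnEnergy < (cccGraph G).cnslEnergy ∧
    (cccGraph G).cnslEnergy < (cccGraph G).cnlEnergy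

/-! ### The families of groups

`D_{2n}` is Mathlib's `DihedralGroup n` (of order `2n`), and the dicyclic group `T_{4n}` is Mathlib's
`QuaternionGroup n` (of order `4n`). The other families are given by their presentations on two
generators `x` and `y`; a relation `u = v` is entered as `u * v⁻¹`. -/

namespace GroupFamilies

/-- The generator `x` of the free group. -/
def x : FreeGroup (Fin 2) := FreeGroup.of 0

/-- The generator `y` of the free group. -/
def y : FreeGroup (Fin 2) := FreeGroup.of 1

/-- `x^(2n) = y^m = 1`, `x⁻¹ y x = y⁻¹`. -/
def relsU (n m : ℕ) : Set (FreeGroup (Fin 2)) :=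
  {x ^ (2 * n), y ^ m, x⁻¹ * y * x * (y⁻¹)⁻¹}

/-- `x^(4n) = y^2 = 1`, `y x y = x^(2n-1)`. -/
def relsSD (n : ℕ) : Set (FreeGroup (Fin 2)) :=
  {x ^ (4 * n), y ^ 2, y * x * y * (x ^ (2 * n - 1))⁻¹}

/-- `x^(2n) = y^4 = 1`, `y x = x⁻¹ y⁻¹`, `y⁻¹ x = x⁻¹ y`. -/
def relsV (n : ℕ) : Set (FreeGroup (Fin 2)) :=
  {x ^ (2 * n), y ^ 4, y * x * (x⁻¹ * y⁻¹)⁻¹, y⁻¹ * x * (x⁻¹ * y)⁻¹}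

/-- The group `U_(n,m)`. -/
abbrev U (n m : ℕ) : Type := PresentedGroup (relsU n m)

/-- The group `U_{6n} = ⟨x, y : x^(2n) = y^3 = 1, x⁻¹ y x = y⁻¹⟩`, which is `U_(n,3)`. -/
abbrev U6 (n : ℕ) : Type := U n 3

/-- The semidihedral group `SD_{8n}`, indexed by `n`. -/
abbrev SD (n : ℕ) : Type := PresentedGroup (relsSD n)

/-- The group `V_{8n}`, indexed by `n`. -/
abbrev V (n : ℕ) : Type := PresentedGroup (relsV n)

/-! These groups are finite, so that their graphs are. -/

theorem finite_of_two_generators {G : Type*} [Group G] (a b : G)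
    (hgen : Subgroup.closure {a, b} = ⊤) (ha : IsOfFinOrder a) (hb : IsOfFinOrder b)
    (h : ∀ j : ℤ, ∃ i k : ℤ, b ^ j * a = a ^ i * b ^ k) : Finite G := by
  let S : Set G := Set.image2 (· * ·) (Subgroup.zpowers a : Set G) (Subgroup.zpowers b : Set G)
  have hSfin : S.Finite :=
    Set.Finite.image2 _ (finite_zpowers.2 ha) (finite_zpowers.2 hb)
  have hSa : ∀ s ∈ S, s * a ∈ S := by
    rintro _ ⟨_, ⟨i, rfl⟩, _, ⟨j, rfl⟩, rfl⟩
    obtain ⟨i', k, e⟩ := h j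
    refine ⟨a ^ (i + i'), ⟨_, rfl⟩, b ^ k, ⟨_, rfl⟩, ?_⟩
    simp only [mul_assoc, e, zpow_add]
  have hSb : ∀ s ∈ S, s * b ∈ S := by
    rintro _ ⟨_, ⟨i, rfl⟩, _, ⟨j, rfl⟩, rfl⟩
    refine ⟨a ^ i, ⟨_, rfl⟩, b ^ (j + 1), ⟨_, rfl⟩, ?_⟩
    simp only [mul_assoc, zpow_add_one]
  have hpow : ∀ c : G, (∀ s ∈ S, s * c ∈ S) → ∀ (k : ℕ), ∀ s ∈ S, s * c ^ k ∈ S := by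
    intro c hc k
    induction k with
    | zero => intro s hs; simpa using hs
    | succ k ih => intro s hs; rw [pow_succ, ← mul_assoc]; exact hc _ (ih s hs)
  have hinv : ∀ c : G, IsOfFinOrder c → (∀ s ∈ S, s * c ∈ S) → ∀ s ∈ S, s * c⁻¹ ∈ S := by
    intro c hc hSc s hs
    obtain ⟨k, hk, e⟩ := isOfFinOrder_iff_pow_eq_one.1 hc
    have : c⁻¹ = c ^ (k - 1) := by
      rw [inv_eq_iff_mul_eq_one, ← pow_succ', Nat.sub_add_cancel hk, e]
    rw [this]
    exact hpow c hSc _ s hs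
  have hall : ∀ g : G, g ∈ S := by
    intro g
    have hg : g ∈ Subgroup.closure {a, b} := hgen ▸ Subgroup.mem_top g
    induction hg using Subgroup.closure_induction_right with
    | one => exact ⟨1, one_mem _, 1, one_mem _, by simp⟩
    | mul_right s hs c hc ih =>
      rcases hc with rfl | rfl
      · exact hSa _ ih
      · exact hSb _ ih
    | mul_inv_cancel s hs c hc ih =>
      rcases hc with rfl | rfl
      · exact hinv _ ha hSa _ ih
      · exact hinv _ hb hSb _ ih
  exact Set.finite_univ_iff.1 (hSfin.subset fun g _ => hall g)

theorem closure_of (rels : Set (FreeGroup (Fin 2))) :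
    Subgroup.closure {PresentedGroup.mk rels x, PresentedGroup.mk rels y} = ⊤ := by
  rw [← PresentedGroup.closure_range_of rels]
  congr 1
  ext g
  simp only [Set.mem_insert_iff, Set.mem_singleton_iff, Set.mem_range, Fin.exists_fin_two]
  constructor <;> rintro (h | h) <;> [left; right; left; right] <;> exact h.symm

instance (n m : ℕ) [NeZero n] [NeZero m] : Finite (U n m) := by
  have hx := PresentedGroup.one_of_mem (rels := relsU n m) (x := x ^ (2 * n)) (by simp [relsU])
  have hy := PresentedGroup.one_of_mem (rels := relsU n m) (x := y ^ m) (by simp [relsU])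
  have hr := PresentedGroup.mk_eq_mk_of_mul_inv_mem (rels := relsU n m)
    (x := x⁻¹ * y * x) (y := y⁻¹) (by simp [relsU])
  simp only [map_pow, map_mul, map_inv] at hx hy hr
  refine finite_of_two_generators _ _ (closure_of _)
    (isOfFinOrder_iff_pow_eq_one.2 ⟨_, by have := NeZero.pos n; omega, hx⟩)
    (isOfFinOrder_iff_pow_eq_one.2 ⟨_, NeZero.pos m, hy⟩) fun j => ⟨1, -j, ?_⟩
  have hs : SemiconjBy (PresentedGroup.mk (relsU n m) x) (PresentedGroup.mk (relsU n m) y)⁻¹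
      (PresentedGroup.mk (relsU n m) y) := by
    rw [SemiconjBy, ← hr]; group
  have := (hs.zpow_right j).eq
  rw [← this]; simp

instance (n : ℕ) [NeZero n] : Finite (SD n) := by
  have hx := PresentedGroup.one_of_mem (rels := relsSD n) (x := x ^ (4 * n)) (by simp [relsSD])
  have hy := PresentedGroup.one_of_mem (rels := relsSD n) (x := y ^ 2) (by simp [relsSD])
  have hr := PresentedGroup.mk_eq_mk_of_mul_inv_mem (rels := relsSD n)
    (x := y * x * y) (y := x ^ (2 * n - 1)) (by simp [relsSD])
  simp only [map_pow, map_mul] at hx hy hr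
  refine finite_of_two_generators _ _ ((Set.pair_comm _ _) ▸ closure_of _)
    (isOfFinOrder_iff_pow_eq_one.2 ⟨_, two_pos, hy⟩)
    (isOfFinOrder_iff_pow_eq_one.2 ⟨_, by have := NeZero.pos n; omega, hx⟩)
    fun j => ⟨1, ((2 * n - 1 : ℕ) : ℤ) * j, ?_⟩
  have hs : SemiconjBy (PresentedGroup.mk (relsSD n) y)
      (PresentedGroup.mk (relsSD n) x ^ (2 * n - 1)) (PresentedGroup.mk (relsSD n) x) := by
    rw [SemiconjBy, ← hr, ← mul_assoc, ← mul_assoc, ← pow_two, hy, one_mul]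
  have := (hs.zpow_right j).eq
  rw [← this, zpow_mul]; simp

instance (n : ℕ) [NeZero n] : Finite (V n) := by
  have hx := PresentedGroup.one_of_mem (rels := relsV n) (x := x ^ (2 * n)) (by simp [relsV])
  have hy := PresentedGroup.one_of_mem (rels := relsV n) (x := y ^ 4) (by simp [relsV])
  have hr := PresentedGroup.mk_eq_mk_of_mul_inv_mem (rels := relsV n)
    (x := y * x) (y := x⁻¹ * y⁻¹) (by simp [relsV])
  have ht := PresentedGroup.mk_eq_mk_of_mul_inv_mem (rels := relsV n)
    (x := y⁻¹ * x) (y := x⁻¹ * y) (by simp [relsV])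
  simp only [map_pow, map_mul, map_inv] at hx hy hr ht
  refine finite_of_two_generators _ _ (closure_of _)
    (isOfFinOrder_iff_pow_eq_one.2 ⟨_, by have := NeZero.pos n; omega, hx⟩)
    (isOfFinOrder_iff_pow_eq_one.2 ⟨_, by norm_num, hy⟩) fun j => ?_
  generalize PresentedGroup.mk (relsV n) x = a at *
  generalize PresentedGroup.mk (relsV n) y = b at *
  have hinv : b * a⁻¹ = a * b⁻¹ := by
    have := congrArg (·⁻¹) ht
    simp only [mul_inv_rev, inv_inv] at this
    calc b * a⁻¹ = b * (a⁻¹ * b) * b⁻¹ := by group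
      _ = a * b⁻¹ := by rw [← ht]; group
  have hb4 : b ^ (4 : ℤ) = 1 := by exact_mod_cast hy
  have hsq : SemiconjBy a (b ^ (2 : ℤ)) (b ^ (2 : ℤ)) := by
    have h1 : b ^ (2 : ℤ) * a = a * b ^ (-2 : ℤ) := by
      calc b ^ (2 : ℤ) * a = b * (b * a) := by rw [zpow_two, mul_assoc]
        _ = b * a⁻¹ * b⁻¹ := by rw [hr, mul_assoc]
        _ = a * b ^ (-2 : ℤ) := by rw [hinv]; group
    have h2 : b ^ (-2 : ℤ) = b ^ (2 : ℤ) := by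
      rw [show (-2 : ℤ) = 2 - 4 by norm_num, zpow_sub, hb4]; simp
    rw [SemiconjBy, h1, h2]
  obtain ⟨k, rfl | rfl⟩ := Int.even_or_odd' j
  · refine ⟨1, 2 * k, ?_⟩
    have := (hsq.zpow_right k).eq
    rw [← zpow_mul] at this
    rw [← this, zpow_one]
  · refine ⟨-1, 2 * k - 1, ?_⟩
    have := (hsq.inv_symm_left.zpow_right k).eq
    rw [← zpow_mul] at this
    rw [zpow_add, zpow_one, mul_assoc, hr, ← mul_assoc, ← this, zpow_sub, zpow_neg,
      zpow_one, zpow_one, mul_assoc]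

end GroupFamilies

/-!
Each of the groups is an extension of an abelian group `A` by one element `t`, which acts on `A` by
an involution `σ`. Put `δ = σ - 1`, so that `δ A` is the commutator subgroup and `ker δ` is the
center of the group. The noncentral elements of `A` have classes of size `2` and commute with each
other; the elements of the coset `A * t` have classes of size `d = |δ A|`, and two such classes are
joined exactly when they agree modulo `δ A + ker δ`. Hence `Γ_G` is a disjoint union of one complete
graph `K_p` and `r = |δ A ∩ ker δ|` copies of a complete graph `K_q`, where `2 p = |A| - |ker δ|`
and `r q = |ker δ|`.

The spectra are then explicit. If `CN` has constant row sums, which happens for `p = q` and for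
`p = 2`, `q = 1`, the Laplacian spectra are shifts of the spectrum of `CN` or of its negative, and
the three energies agree. Otherwise `(r + 1) q ≤ p` and `p ≥ 3`; the mean `Δ` then lies above
every Laplacian and signless Laplacian eigenvalue of the small cliques and below the largest ones of
`K_p`, so all absolute values but one are determined and the strict inequalities follow. Comparing
sizes, the first case occurs exactly when `d = 2`, `d = 3` or `|A| = 5`.
-/

section Charpoly

open Polynomial

variable {n R : Type*} [Fintype n] [DecidableEq n] [CommRing R]

theorem charpoly_scalar_add_const [Nonempty n] (a b : R) :
    (Matrix.scalar n a + Matrix.of fun _ _ => b).charpoly =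
      (X - C (a + Fintype.card n * b)) * (X - C a) ^ (Fintype.card n - 1) := by
  have hconst : Matrix.scalar n a + (Matrix.of fun _ _ => b) =
      Matrix.vecMulVec (fun _ => b) (fun _ => 1) - Matrix.scalar n (-a) := by
    rw [map_neg, sub_neg_eq_add, add_comm]
    ext i j
    simp [Matrix.vecMulVec]
  obtain ⟨k, hk⟩ := Nat.exists_eq_succ_of_ne_zero (Fintype.card_ne_zero (α := n))
  rw [hconst, Matrix.charpoly_sub_scalar, Matrix.charpoly_vecMulVec, hk]
  simp [dotProduct, hk, pow_succ, smul_eq_C_mul]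
  ring

theorem charpoly_neg (M : Matrix n n R) :
    (-M).charpoly = (-1) ^ Fintype.card n * M.charpoly.comp (-X) := by
  have hcomp : M.charpoly.comp (-X) = (M.charmatrix.map (compRingHom (-X))).det := by
    rw [Matrix.charpoly, ← coe_compRingHom_apply, RingHom.map_det]
    rfl
  rw [hcomp, ← Matrix.det_neg, Matrix.charpoly]
  congr 1
  ext i j : 2
  by_cases h : i = j <;> simp [h, Matrix.charmatrix_apply_ne, add_comm]

end Charpoly

section Deviation

open SimpleGraph

variable {V : Type*} [Fintype V]

open Classical in
theorem eigenvalueDeviation_sub_scalar (M : Matrix V V ℝ) (a c : ℝ) :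
    eigenvalueDeviation (M - Matrix.scalar V a) c = eigenvalueDeviation M (a + c) := by
  have hroots := Polynomial.roots_comp_C_mul_X_add_C M.charpoly 1 a isUnit_one
  rw [map_one, one_mul] at hroots
  rw [eigenvalueDeviation, Matrix.charpoly_sub_scalar, hroots, Multiset.map_map,
    eigenvalueDeviation]
  simp [sub_sub]

theorem eigenvalueDeviation_neg (M : Matrix V V ℝ) (c : ℝ) :
    eigenvalueDeviation (-M) c = eigenvalueDeviation M (-c) := by
  classical
  have hroots : (-M).charpoly.roots = M.charpoly.roots.map fun t => -t := by
    rw [charpoly_neg, ← Polynomial.roots_comp_neg_X]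
    rcases neg_one_pow_eq_or (Polynomial ℝ) (Fintype.card V) with h | h <;> simp [h]
  rw [eigenvalueDeviation, hroots, Multiset.map_map, eigenvalueDeviation]
  congr 2
  ext t
  rw [Function.comp_apply, abs_sub_comm, sub_neg_eq_add, add_comm, sub_neg_eq_add]

theorem cnEnergies_eq_of_row_sum_eq [Nonempty V] {Γ : SimpleGraph V} {c : ℝ}
    (hc : ∀ v, ∑ w, Γ.cnMatrix v w = c) :
    Γ.cnEnergy = Γ.cnslEnergy ∧ Γ.cnslEnergy = Γ.cnlEnergy := by
  classical
  have hrs : Γ.cnrsMatrix = Matrix.scalar V c := by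
    simp only [cnrsMatrix, hc, Matrix.scalar_apply]
  have hmean : Γ.cnMean = c := by
    rw [cnMean, hrs, Matrix.scalar_apply, Matrix.trace_diagonal]
    simp
  have hcnsl : Γ.cnslEnergy = Γ.cnEnergy := by
    have : Γ.cnslMatrix - Matrix.scalar V c = Γ.cnMatrix := by
      rw [cnslMatrix, hrs, add_sub_cancel_left]
    rw [cnslEnergy, hmean, cnEnergy, ← this, eigenvalueDeviation_sub_scalar, add_zero]
  have hcnl : Γ.cnlEnergy = Γ.cnEnergy := by
    have : Γ.cnlMatrix - Matrix.scalar V c = -Γ.cnMatrix := by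
      rw [cnlMatrix, hrs, sub_sub_cancel_left]
    rw [cnlEnergy, hmean, cnEnergy, ← neg_neg Γ.cnMatrix, ← this, eigenvalueDeviation_neg,
      eigenvalueDeviation_sub_scalar, neg_zero, add_zero]
  exact ⟨hcnsl.symm, hcnsl.trans hcnl.symm⟩

end Deviation

section Cluster

open SimpleGraph

variable {V ι : Type*}

open Classical in
/-- The matrix that is zero outside the square blocks given by the fibers of `f`, and is the sum
of `a i` times the identity and `b i` times the all-ones matrix on the block of `i`. -/
noncomputable def clusterMatrix (f : V → ι) (a b : ι → ℝ) : Matrix V V ℝ :=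
  Matrix.of fun v w => if f v = f w then (if v = w then a (f v) else 0) + b (f v) else 0

/-- `Γ` is a disjoint union of complete graphs: its components are the fibers of the surjective
labelling `f`, the one with label `i` having `m i` vertices. -/
structure IsClusterGraph (Γ : SimpleGraph V) (f : V → ι) (m : ι → ℕ) : Prop where
  adj_iff (v w : V) : Γ.Adj v w ↔ v ≠ w ∧ f v = f w
  surjective : Function.Surjective f
  card_fiber (i : ι) : Nat.card {v // f v = i} = m i

namespace IsClusterGraph

variable {Γ : SimpleGraph V} {f : V → ι} {m : ι → ℕ} (h : IsClusterGraph Γ f m)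

include h

theorem ncard_commonNeighbors [Finite V] {v w : V} (hvw : v ≠ w) (hf : f v = f w) :
    (Γ.commonNeighbors v w).ncard + 2 = m (f v) := by
  have hv : v ∉ insert w (Γ.commonNeighbors v w) := by simp [mem_commonNeighbors, hvw]
  have hw : w ∉ Γ.commonNeighbors v w := by simp [mem_commonNeighbors]
  have hset : insert v (insert w (Γ.commonNeighbors v w)) = {u | f u = f v} := by
    ext u
    simp only [Set.mem_insert_iff, mem_commonNeighbors, h.adj_iff, Set.mem_ofPred_eq]
    grind
  rw [← h.card_fiber, ← Set.coe_ofPred, Nat.card_coe_set_eq, ← hset,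
    Set.ncard_insert_of_notMem hv (Set.toFinite _),
    Set.ncard_insert_of_notMem hw (Set.toFinite _)]

theorem cnMatrix_eq [Finite V] :
    Γ.cnMatrix = clusterMatrix f (fun i => -((m i : ℝ) - 2)) (fun i => (m i : ℝ) - 2) := by
  ext v w
  rw [cnMatrix, clusterMatrix, Matrix.of_apply, Matrix.of_apply]
  by_cases hvw : v = w
  · simp [hvw]
  by_cases hf : f v = f w
  · simp [hvw, hf, ← h.ncard_commonNeighbors (Ne.symm hvw) hf.symm, commonNeighbors_symm]
  · have hempty : Γ.commonNeighbors v w = ∅ :=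
      Set.eq_empty_of_forall_notMem fun u hu => hf <|
        ((h.adj_iff v u).1 hu.1).2.trans ((h.adj_iff w u).1 hu.2).2.symm
    simp [hvw, hf, hempty]

end IsClusterGraph

variable [Fintype V]

open Classical in
theorem charpoly_clusterMatrix [Fintype ι] {f : V → ι} (hf : Function.Surjective f)
    (a b : ι → ℝ) :
    (clusterMatrix f a b).charpoly = ∏ i, (Polynomial.X -
      Polynomial.C (a i + Nat.card {v // f v = i} * b i)) *
        (Polynomial.X - Polynomial.C (a i)) ^ (Nat.card {v // f v = i} - 1) := by
  let _ : LinearOrder ι := LinearOrder.lift' (Fintype.equivFin ι) (Fintype.equivFin ι).injective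
  have htri : (clusterMatrix f a b).BlockTriangular f := fun v w h => if_neg h.ne'
  rw [htri.charpoly]
  refine Finset.prod_congr (Finset.eq_univ_of_forall fun i => ?_) fun i _ => ?_
  · obtain ⟨v, rfl⟩ := hf i
    exact Finset.mem_image_of_mem f (Finset.mem_univ v)
  · obtain ⟨v, hv⟩ := hf i
    have : Nonempty {v // f v = i} := ⟨⟨v, hv⟩⟩
    have hblock : (clusterMatrix f a b).toSquareBlock f i =
        Matrix.scalar _ (a i) + Matrix.of fun _ _ => b i := by
      ext ⟨v, hv⟩ ⟨w, hw⟩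
      simp [clusterMatrix, Matrix.toSquareBlock_def, Matrix.diagonal_apply, hv, hw]
    rw [hblock, Nat.card_eq_fintype_card]
    exact charpoly_scalar_add_const (a i) (b i)

theorem eigenvalueDeviation_clusterMatrix [Fintype ι] {f : V → ι} (hf : Function.Surjective f)
    (a b : ι → ℝ) (c : ℝ) :
    eigenvalueDeviation (clusterMatrix f a b) c =
      ∑ i, (|a i + Nat.card {v // f v = i} * b i - c| +
        ((Nat.card {v // f v = i} : ℝ) - 1) * |a i - c|) := by
  have hfactor (i : ι) := mul_ne_zero
    (Polynomial.X_sub_C_ne_zero (a i + Nat.card {v // f v = i} * b i))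
    (pow_ne_zero (Nat.card {v // f v = i} - 1) (Polynomial.X_sub_C_ne_zero (a i)))
  rw [eigenvalueDeviation, charpoly_clusterMatrix hf,
    Polynomial.roots_prod _ _ (Finset.prod_ne_zero_iff.2 fun i _ => hfactor i),
    Multiset.map_bind, Multiset.sum_bind]
  refine Finset.sum_congr rfl fun i _ => ?_
  obtain ⟨v, hv⟩ := hf i
  have hpos : 1 ≤ Nat.card {v // f v = i} := Nat.card_pos_iff.2 ⟨⟨⟨v, hv⟩⟩, inferInstance⟩
  rw [Polynomial.roots_mul (hfactor i), Polynomial.roots_pow, Polynomial.roots_X_sub_C,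
    Polynomial.roots_X_sub_C, ← Nat.cast_pred hpos]
  simp [Multiset.map_nsmul, Multiset.sum_nsmul]

namespace IsClusterGraph

variable {Γ : SimpleGraph V} {f : V → ι} {m : ι → ℕ} (h : IsClusterGraph Γ f m)

include h

theorem sum_comp_label [Fintype ι] (g : ι → ℝ) : ∑ v, g (f v) = ∑ i, m i * g i := by
  classical
  rw [← Finset.sum_fiberwise Finset.univ f]
  refine Finset.sum_congr rfl fun i _ => ?_
  rw [Finset.sum_congr rfl fun v hv => congrArg g (Finset.mem_filter.1 hv).2, Finset.sum_const,
    nsmul_eq_mul, ← h.card_fiber, Nat.card_eq_fintype_card, Fintype.card_subtype]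

theorem sum_cnMatrix (v : V) :
    ∑ w, Γ.cnMatrix v w = ((m (f v) : ℝ) - 1) * ((m (f v) : ℝ) - 2) := by
  classical
  have hsplit (w : V) : Γ.cnMatrix v w = (if v = w then -((m (f v) : ℝ) - 2) else 0) +
      if f w = f v then (m (f v) : ℝ) - 2 else 0 := by
    rw [h.cnMatrix_eq, clusterMatrix, Matrix.of_apply]
    by_cases hvw : v = w
    · simp [hvw]
    · simp [hvw, eq_comm]
  simp_rw [hsplit]
  rw [Finset.sum_add_distrib, Finset.sum_ite_eq, ← Finset.sum_filter, Finset.sum_const,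
    nsmul_eq_mul, ← Fintype.card_subtype, ← Nat.card_eq_fintype_card, h.card_fiber]
  simp only [Finset.mem_univ, if_true]
  ring

open Classical in
theorem cnrsMatrix_eq :
    Γ.cnrsMatrix = Matrix.diagonal fun v => ((m (f v) : ℝ) - 1) * ((m (f v) : ℝ) - 2) := by
  simp only [cnrsMatrix, h.sum_cnMatrix]

theorem cnMean_eq [Fintype ι] :
    Γ.cnMean = (∑ i, m i * (((m i : ℝ) - 1) * ((m i : ℝ) - 2))) / ∑ i, (m i : ℝ) := by
  classical
  have hcard : (Fintype.card V : ℝ) = ∑ i, (m i : ℝ) := by simpa using h.sum_comp_label 1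
  rw [cnMean, h.cnrsMatrix_eq, Matrix.trace_diagonal, hcard,
    h.sum_comp_label fun i => ((m i : ℝ) - 1) * ((m i : ℝ) - 2)]

theorem cnEnergy_eq [Fintype ι] :
    Γ.cnEnergy =
      ∑ i, (|((m i : ℝ) - 1) * ((m i : ℝ) - 2)| + ((m i : ℝ) - 1) * |(m i : ℝ) - 2|) := by
  rw [cnEnergy, h.cnMatrix_eq, eigenvalueDeviation_clusterMatrix h.surjective]
  refine Finset.sum_congr rfl fun i _ => ?_
  rw [h.card_fiber, sub_zero, sub_zero, abs_neg]
  ring_nf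

theorem cnlEnergy_eq [Fintype ι] :
    Γ.cnlEnergy =
      ∑ i, (|Γ.cnMean| + ((m i : ℝ) - 1) * |m i * ((m i : ℝ) - 2) - Γ.cnMean|) := by
  have hmatrix : Γ.cnlMatrix = clusterMatrix f (fun i => m i * ((m i : ℝ) - 2))
      (fun i => -((m i : ℝ) - 2)) := by
    ext v w
    rw [cnlMatrix, h.cnrsMatrix_eq, h.cnMatrix_eq]
    by_cases hvw : v = w
    · simp [clusterMatrix, hvw]; ring
    · simp [clusterMatrix, hvw]; grind
  rw [cnlEnergy, hmatrix, eigenvalueDeviation_clusterMatrix h.surjective]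
  refine Finset.sum_congr rfl fun i _ => ?_
  rw [h.card_fiber, mul_neg, add_neg_cancel, zero_sub, abs_neg]

theorem cnslEnergy_eq [Fintype ι] :
    Γ.cnslEnergy = ∑ i, (|2 * (((m i : ℝ) - 1) * ((m i : ℝ) - 2)) - Γ.cnMean| +
      ((m i : ℝ) - 1) * |((m i : ℝ) - 2) ^ 2 - Γ.cnMean|) := by
  have hmatrix : Γ.cnslMatrix = clusterMatrix f (fun i => ((m i : ℝ) - 2) ^ 2)
      (fun i => (m i : ℝ) - 2) := by
    ext v w
    rw [cnslMatrix, h.cnrsMatrix_eq, h.cnMatrix_eq]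
    by_cases hvw : v = w
    · simp [clusterMatrix, hvw]; ring
    · simp [clusterMatrix, hvw]
  rw [cnslEnergy, hmatrix, eigenvalueDeviation_clusterMatrix h.surjective]
  refine Finset.sum_congr rfl fun i _ => ?_
  rw [h.card_fiber]
  ring_nf

theorem cnEnergies_eq [Nonempty V] {c : ℝ} (hc : ∀ i, ((m i : ℝ) - 1) * ((m i : ℝ) - 2) = c) :
    Γ.cnEnergy = Γ.cnslEnergy ∧ Γ.cnslEnergy = Γ.cnlEnergy :=
  cnEnergies_eq_of_row_sum_eq fun v => (h.sum_cnMatrix v).trans (hc (f v))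

end IsClusterGraph

end Cluster

section OneLargeClique

theorem cnMean_bounds {p q r Δ : ℝ} (hp : 3 ≤ p) (hq : 1 ≤ q) (hr : 1 ≤ r)
    (hrq : (r + 1) * q ≤ p) (he : 0 ≤ (q - 1) * (q - 2))
    (hΔ : Δ * (p + r * q) = p * ((p - 1) * (p - 2)) + r * (q * ((q - 1) * (q - 2)))) :
    0 < Δ ∧ 2 * ((q - 1) * (q - 2)) ≤ Δ ∧
      Δ + r * ((q - 1) * (q - 2)) < (p - 1) * (p - 2) := by
  obtain ⟨t, rfl⟩ : ∃ t, q = 1 + t := ⟨q - 1, by ring⟩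
  obtain ⟨s, rfl⟩ : ∃ s, p = 2 * (1 + t) + s := ⟨p - 2 * (1 + t), by ring⟩
  have ht : 0 ≤ t := by linarith
  have hs : 0 ≤ s := by nlinarith
  have hN : 0 < 2 * (1 + t) + s + r * (1 + t) := by positivity
  set p := 2 * (1 + t) + s with hp_def
  set e := (1 + t - 1) * (1 + t - 2) with he_def
  set D := (p - 1) * (p - 2) with hD_def
  have hD : 0 < D := by rw [hD_def]; nlinarith
  have hrqe : r * (1 + t) * e ≤ (p - (1 + t)) * e := by gcongr; linarith
  have hD3 : 3 * e ≤ D := by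
    have : D - 3 * e = t * (5 + t) + s * (1 + 4 * t) + s ^ 2 := by
      rw [hD_def, he_def, hp_def]; ring
    linarith [show 0 ≤ t * (5 + t) + s * (1 + 4 * t) + s ^ 2 by positivity]
  have hDq : 2 * p * e < (1 + t) * D := by
    have : (1 + t) * D - 2 * p * e = (2 * t + s) + (4 * t + 6 * t ^ 2 + 7 * t * s + s ^ 2 +
        2 * t ^ 2 * s + t * s ^ 2) := by
      rw [hD_def, he_def, hp_def]; ring
    linarith [show 0 ≤ 4 * t + 6 * t ^ 2 + 7 * t * s + s ^ 2 + 2 * t ^ 2 * s + t * s ^ 2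
      by positivity]
  refine ⟨?_, ?_, ?_⟩
  · exact pos_of_mul_pos_left (hΔ ▸ by positivity) hN.le
  · refine le_of_mul_le_mul_right ?_ hN
    nlinarith [hD3]
  · refine lt_of_mul_lt_mul_right ?_ hN.le
    nlinarith

theorem sub_one_mul_sub_two_nonneg (k : ℕ) : 0 ≤ ((k : ℝ) - 1) * ((k : ℝ) - 2) := by
  obtain hk | rfl | hk : k < 1 ∨ k = 1 ∨ 2 ≤ k := by omega
  · norm_num [Nat.lt_one_iff.1 hk]
  · norm_num
  · have : (2 : ℝ) ≤ k := by exact_mod_cast hk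
    nlinarith

open SimpleGraph

variable {V κ : Type*} [Fintype V] [Fintype κ] {Γ : SimpleGraph V} {f : V → Option κ} {p q : ℕ}
  (h : IsClusterGraph Γ f fun i => i.elim p fun _ => q)

namespace IsClusterGraph

include h

theorem cnMean_mul_of_option (hp : 0 < p) :
    Γ.cnMean * (p + Fintype.card κ * q) = p * (((p : ℝ) - 1) * ((p : ℝ) - 2)) +
      Fintype.card κ * (q * (((q : ℝ) - 1) * ((q : ℝ) - 2))) := by
  have hN : (p + Fintype.card κ * q : ℝ) ≠ 0 := by positivity
  rw [h.cnMean_eq, Fintype.sum_option, Fintype.sum_option]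
  simp only [Option.elim_none, Option.elim_some, Finset.sum_const, Finset.card_univ, nsmul_eq_mul]
  exact div_mul_cancel₀ _ hN

theorem cnEnergy_of_option (hp : 2 ≤ p) (hq : 1 ≤ q) :
    Γ.cnEnergy = 2 * (((p : ℝ) - 1) * ((p : ℝ) - 2) +
      Fintype.card κ * (((q : ℝ) - 1) * ((q : ℝ) - 2))) := by
  have hterm (k : ℕ) (hk : 1 ≤ k) : |((k : ℝ) - 1) * ((k : ℝ) - 2)| +
      ((k : ℝ) - 1) * |(k : ℝ) - 2| = 2 * (((k : ℝ) - 1) * ((k : ℝ) - 2)) := by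
    have hk1 : 0 ≤ (k : ℝ) - 1 := sub_nonneg.2 (by exact_mod_cast hk)
    rw [← abs_of_nonneg (sub_one_mul_sub_two_nonneg k), abs_abs, abs_mul, abs_of_nonneg hk1,
      two_mul]
  rw [h.cnEnergy_eq, Fintype.sum_option]
  simp only [Option.elim_none, Option.elim_some, Finset.sum_const, Finset.card_univ, nsmul_eq_mul]
  rw [hterm p (by omega), hterm q hq]
  ring

variable [Nonempty κ] (hp : 3 ≤ p) (hq : 1 ≤ q) (hrq : (Fintype.card κ + 1) * q ≤ p)

include hp hq hrq

theorem cnMean_bounds_of_option :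
    0 < Γ.cnMean ∧ 2 * (((q : ℝ) - 1) * ((q : ℝ) - 2)) ≤ Γ.cnMean ∧
      Γ.cnMean + Fintype.card κ * (((q : ℝ) - 1) * ((q : ℝ) - 2)) <
        ((p : ℝ) - 1) * ((p : ℝ) - 2) :=
  cnMean_bounds (by exact_mod_cast hp) (by exact_mod_cast hq)
    (by exact_mod_cast Fintype.card_pos (α := κ)) (by exact_mod_cast hrq)
    (sub_one_mul_sub_two_nonneg q) (h.cnMean_mul_of_option (by omega))

theorem cnMean_lt_of_option : Γ.cnMean < ((p : ℝ) - 1) * ((p : ℝ) - 2) := by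
  obtain ⟨-, -, hlt⟩ := h.cnMean_bounds_of_option hp hq hrq
  have := mul_nonneg (Nat.cast_nonneg (α := ℝ) (Fintype.card κ)) (sub_one_mul_sub_two_nonneg q)
  linarith

theorem mul_abs_sub_cnMean {x : ℝ}
    (hx : 2 ≤ q → x ≤ 2 * (((q : ℝ) - 1) * ((q : ℝ) - 2))) :
    ((q : ℝ) - 1) * |x - Γ.cnMean| = ((q : ℝ) - 1) * (Γ.cnMean - x) := by
  obtain rfl | hq2 : q = 1 ∨ 2 ≤ q := by omega
  · norm_num
  · obtain ⟨-, he, -⟩ := h.cnMean_bounds_of_option hp hq hrq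
    rw [abs_sub_comm, abs_of_nonneg (sub_nonneg.2 ((hx hq2).trans he))]

theorem cnlEnergy_of_option :
    Γ.cnlEnergy = 2 * (((p : ℝ) - 1) * (p * ((p : ℝ) - 2) - Γ.cnMean)) := by
  obtain ⟨hpos, -, -⟩ := h.cnMean_bounds_of_option hp hq hrq
  have hlt := h.cnMean_lt_of_option hp hq hrq
  have hmean := h.cnMean_mul_of_option (by omega)
  have hp3 : (3 : ℝ) ≤ p := by exact_mod_cast hp
  have hsmall := h.mul_abs_sub_cnMean hp hq hrq (x := q * ((q : ℝ) - 2)) fun hq2 => by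
    have : (2 : ℝ) ≤ q := by exact_mod_cast hq2
    nlinarith
  have hlarge : 0 ≤ p * ((p : ℝ) - 2) - Γ.cnMean := by
    nlinarith
  rw [h.cnlEnergy_eq, Fintype.sum_option]
  simp only [Option.elim_none, Option.elim_some, Finset.sum_const, Finset.card_univ, nsmul_eq_mul]
  rw [hsmall, abs_of_pos hpos, abs_of_nonneg hlarge]
  linear_combination hmean

theorem cnslEnergy_of_option :
    Γ.cnslEnergy = 2 * (2 * (((p : ℝ) - 1) * ((p : ℝ) - 2)) - Γ.cnMean +
      ((p : ℝ) - 1) * max (((p : ℝ) - 2) ^ 2 - Γ.cnMean) 0) := by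
  obtain ⟨-, he, -⟩ := h.cnMean_bounds_of_option hp hq hrq
  have hlt := h.cnMean_lt_of_option hp hq hrq
  have hmean := h.cnMean_mul_of_option (by omega)
  have hp3 : (3 : ℝ) ≤ p := by exact_mod_cast hp
  have hsmall := h.mul_abs_sub_cnMean hp hq hrq (x := ((q : ℝ) - 2) ^ 2) fun hq2 => by
    have : (2 : ℝ) ≤ q := by exact_mod_cast hq2
    nlinarith
  have hlarge : 0 ≤ 2 * (((p : ℝ) - 1) * ((p : ℝ) - 2)) - Γ.cnMean := by
    nlinarith
  have hmax (t : ℝ) : |t| = 2 * max t 0 - t := by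
    rcases le_total 0 t with ht | ht <;> simp [ht, abs_of_nonneg, abs_of_nonpos]; ring
  rw [h.cnslEnergy_eq, Fintype.sum_option]
  simp only [Option.elim_none, Option.elim_some, Finset.sum_const, Finset.card_univ, nsmul_eq_mul]
  rw [hsmall, abs_of_nonneg hlarge, abs_sub_comm (2 * _), abs_of_nonneg (sub_nonneg.2 he), hmax]
  linear_combination hmean

theorem cnEnergies_lt :
    Γ.cnEnergy < Γ.cnslEnergy ∧ Γ.cnslEnergy < Γ.cnlEnergy := by
  obtain ⟨hpos, -, hlt_D⟩ := h.cnMean_bounds_of_option hp hq hrq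
  have hp3 : (3 : ℝ) ≤ p := by exact_mod_cast hp
  have hlt := h.cnMean_lt_of_option hp hq hrq
  rw [h.cnEnergy_of_option (by omega) hq, h.cnslEnergy_of_option hp hq hrq,
    h.cnlEnergy_of_option hp hq hrq]
  constructor
  · have : 0 ≤ ((p : ℝ) - 1) * max (((p : ℝ) - 2) ^ 2 - Γ.cnMean) 0 :=
      mul_nonneg (by linarith) (le_max_right _ _)
    linarith
  · rcases le_total (((p : ℝ) - 2) ^ 2 - Γ.cnMean) 0 with hneg | hnonneg
    · rw [max_eq_right hneg]
      nlinarith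
    · rw [max_eq_left hnonneg]
      nlinarith

end IsClusterGraph

end OneLargeClique

section CommutingConjugacyClasses

variable {G H ι : Type*} [Group G] [Group H]

theorem mk_mem_noncenter_iff {g : G} :
    ConjClasses.mk g ∈ ConjClasses.noncenter G ↔ g ∉ Subgroup.center G := by
  refine ⟨fun h hg => (ConjClasses.mk_bijOn G).mapsTo hg h, not_imp_comm.1 fun h => ?_⟩
  obtain ⟨z, hz, hzg⟩ := (ConjClasses.mk_bijOn G).surjOn h
  exact (ConjClasses.mk_eq_mk_iff_isConj.1 hzg).eq_of_left_mem_center hz ▸ hz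

namespace CCCVertex

/-- The conjugacy class of a noncentral element, as a vertex of the commuting conjugacy class
graph. -/
def mk (g : G) (hg : g ∉ Subgroup.center G) : CCCVertex G :=
  ⟨ConjClasses.mk g, mk_mem_noncenter_iff.2 hg⟩

theorem exists_eq_mk_of_mem {c : CCCVertex G} {g : G} (h : g ∈ c.1.carrier) :
    ∃ hg, c = mk g hg := by
  have hc := ConjClasses.mem_carrier_iff_mk_eq.1 h
  exact ⟨mk_mem_noncenter_iff.1 (hc ▸ c.2), Subtype.ext hc.symm⟩

theorem exists_eq_mk (c : CCCVertex G) : ∃ g hg, c = mk g hg := by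
  obtain ⟨g, hg⟩ := ConjClasses.exists_rep c.1
  exact ⟨g, exists_eq_mk_of_mem (ConjClasses.mem_carrier_iff_mk_eq.2 hg)⟩

theorem mk_eq_mk_iff {g h : G} {hg : g ∉ Subgroup.center G} {hh : h ∉ Subgroup.center G} :
    mk g hg = mk h hh ↔ IsConj g h :=
  Subtype.ext_iff.trans ConjClasses.mk_eq_mk_iff_isConj

theorem mem_carrier_mk_iff {g h : G} {hg : g ∉ Subgroup.center G} :
    h ∈ (mk g hg).1.carrier ↔ IsConj g h :=
  Iff.rfl

/-- A class function, as a function on the vertices of the commuting conjugacy class graph. -/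
def lift (label : G → ι) (hconj : ∀ g h, IsConj g h → label g = label h) : CCCVertex G → ι :=
  fun c => Quotient.lift label hconj c.1

theorem adj_mk_iff {g h : G} {hg : g ∉ Subgroup.center G} {hh : h ∉ Subgroup.center G} :
    (cccGraph G).Adj (mk g hg) (mk h hh) ↔
      mk g hg ≠ mk h hh ∧ ∃ h', IsConj h h' ∧ Commute g h' := by
  refine and_congr_right fun _ => ⟨?_, ?_⟩
  · rintro ⟨g', hg', h', hh', hcomm⟩
    obtain ⟨t, rfl⟩ := isConj_iff.1 (mem_carrier_mk_iff.1 hg')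
    refine ⟨t⁻¹ * h' * t, (mem_carrier_mk_iff.1 hh').trans (isConj_iff.2 ⟨t⁻¹, by simp⟩), ?_⟩
    simpa [mul_assoc] using Commute.map hcomm (MulAut.conj t⁻¹)
  · rintro ⟨h', hh', hcomm⟩
    exact ⟨g, IsConj.refl g, h', hh', hcomm⟩

theorem card_mul_card_fiber [Finite G] {label : G → ι}
    {hconj : ∀ g h, IsConj g h → label g = label h} {k : ℕ} {i : ι}
    (hk : ∀ g ∉ Subgroup.center G, label g = i → Nat.card (conjugatesOf g) = k) :
    k * Nat.card {c : CCCVertex G // lift label hconj c = i} =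
      Nat.card {g : G // g ∉ Subgroup.center G ∧ label g = i} := by
  let e (g : {g : G // g ∉ Subgroup.center G ∧ label g = i}) :
      Σ c : {c : CCCVertex G // lift label hconj c = i}, c.1.1.carrier :=
    ⟨⟨mk g.1 g.2.1, g.2.2⟩, g.1, ConjClasses.mem_carrier_mk⟩
  have he : Function.Bijective e := by
    refine ⟨fun g h hgh => Subtype.ext (congrArg (fun c => (c.2 : G)) hgh), ?_⟩
    rintro ⟨⟨c, hc⟩, g, hg⟩
    obtain ⟨hg', rfl⟩ := exists_eq_mk_of_mem hg
    exact ⟨⟨g, hg', hc⟩, rfl⟩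
  have hcard (c : {c : CCCVertex G // lift label hconj c = i}) : Nat.card c.1.1.carrier = k := by
    obtain ⟨c, hc⟩ := c
    obtain ⟨g, hg, rfl⟩ := c.exists_eq_mk
    exact hk g hg hc
  have := Fintype.ofFinite {c : CCCVertex G // lift label hconj c = i}
  rw [Nat.card_congr (Equiv.ofBijective e he), Nat.card_sigma,
    Finset.sum_congr rfl fun c _ => hcard c, Finset.sum_const, Finset.card_univ, smul_eq_mul,
    Nat.card_eq_fintype_card, mul_comm]

theorem isClusterGraph_lift [Finite G] {label : G → ι} {size m : ι → ℕ}
    (hconj : ∀ g h, IsConj g h → label g = label h)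
    (hadj : ∀ g ∉ Subgroup.center G, ∀ h ∉ Subgroup.center G,
      (∃ h', IsConj h h' ∧ Commute g h') ↔ label g = label h)
    (hsurj : ∀ i, ∃ g ∉ Subgroup.center G, label g = i)
    (hsize : ∀ g ∉ Subgroup.center G, Nat.card (conjugatesOf g) = size (label g))
    (hm : ∀ i, size i * m i = Nat.card {g : G // g ∉ Subgroup.center G ∧ label g = i}) :
    IsClusterGraph (cccGraph G) (lift label hconj) m where
  adj_iff c d := by
    obtain ⟨g, hg, rfl⟩ := c.exists_eq_mk
    obtain ⟨h, hh, rfl⟩ := d.exists_eq_mk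
    rw [adj_mk_iff, hadj g hg h hh]
    rfl
  surjective i := by
    obtain ⟨g, hg, hi⟩ := hsurj i
    exact ⟨mk g hg, hi⟩
  card_fiber i := by
    obtain ⟨g, hg, rfl⟩ := hsurj i
    have hpos : 0 < size (label g) := hsize g hg ▸
      Nat.card_pos_iff.2 ⟨⟨⟨g, mem_conjugatesOf_self⟩⟩, inferInstance⟩
    refine Nat.eq_of_mul_eq_mul_left hpos ?_
    rw [hm, card_mul_card_fiber fun h hh hlabel => hlabel ▸ hsize h hh]

end CCCVertex

theorem IsClusterGraph.comp_iso {V W : Type*} {Γ : SimpleGraph V} {Γ' : SimpleGraph W}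
    {f : W → ι} {m : ι → ℕ} (h : IsClusterGraph Γ' f m) (φ : Γ ≃g Γ') :
    IsClusterGraph Γ (f ∘ φ) m where
  adj_iff v w := by rw [← φ.map_adj_iff, h.adj_iff, φ.injective.ne_iff]; rfl
  surjective := h.surjective.comp φ.surjective
  card_fiber i := by
    rw [← h.card_fiber i]
    exact Nat.card_congr (φ.toEquiv.subtypeEquiv fun _ => Iff.rfl)

theorem isConj_map_iff (e : G ≃* H) {g h : G} : IsConj (e g) (e h) ↔ IsConj g h :=
  ⟨fun hc => by simpa using e.symm.toMonoidHom.map_isConj hc, e.toMonoidHom.map_isConj⟩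

theorem map_mem_center_iff (e : G ≃* H) {g : G} :
    e g ∈ Subgroup.center H ↔ g ∈ Subgroup.center G :=
  MulEquivClass.apply_mem_center_iff e

/-- The isomorphism of commuting conjugacy class graphs induced by an isomorphism of groups. -/
def cccGraphIso (e : G ≃* H) : cccGraph G ≃g cccGraph H where
  toEquiv := (Quotient.congr e.toEquiv fun _ _ => (isConj_map_iff e).symm :
    ConjClasses G ≃ ConjClasses H).subtypeEquiv fun c => by
      obtain ⟨g, rfl⟩ := ConjClasses.exists_rep c
      exact mk_mem_noncenter_iff.trans <|
        (map_mem_center_iff e).symm.not.trans mk_mem_noncenter_iff.symm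
  map_rel_iff' {c d} := by
    obtain ⟨g, hg, rfl⟩ := c.exists_eq_mk
    obtain ⟨h, hh, rfl⟩ := d.exists_eq_mk
    refine (CCCVertex.adj_mk_iff (hg := (map_mem_center_iff e).not.2 hg)
      (hh := (map_mem_center_iff e).not.2 hh)).trans ?_
    rw [CCCVertex.adj_mk_iff, Ne, Ne, CCCVertex.mk_eq_mk_iff, CCCVertex.mk_eq_mk_iff,
      isConj_map_iff e, e.surjective.exists]
    simp only [isConj_map_iff, commute_map_iff e.injective]

end CommutingConjugacyClasses

theorem isConj_iff_exists_mul_eq {G : Type*} [Group G] {g h : G} :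
    IsConj g h ↔ ∃ t, t * g = h * t :=
  isConj_iff.trans <| exists_congr fun _ => mul_inv_eq_iff_eq_mul

theorem index_range_sup_ker {A : Type*} [AddCommGroup A] [Finite A] (f : A →+ A) :
    (f.range ⊔ f.ker).index = Nat.card ↥(f.range ⊓ f.ker) := by
  have hindex : f.range.relIndex f.ker * (f.range ⊔ f.ker).index = Nat.card f.ker := by
    rw [← AddSubgroup.relIndex_sup_left, AddSubgroup.relIndex_mul_index le_sup_left,
      AddSubgroup.index_range]
  have hcard : f.range.relIndex f.ker * Nat.card ↥(f.range ⊓ f.ker) = Nat.card f.ker := by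
    rw [← AddSubgroup.inf_relIndex_right, ← AddSubgroup.relIndex_bot_left, mul_comm,
      AddSubgroup.relIndex_mul_relIndex _ _ _ bot_le inf_le_right, AddSubgroup.relIndex_bot_left]
  exact Nat.eq_of_mul_eq_mul_left (Nat.pos_of_ne_zero (left_ne_zero_of_mul (hcard ▸
    Nat.card_pos.ne'))) (hindex.trans hcard.symm)

/-- The data of an extension of the abelian group `A` by an element `t` that acts on `A` as the
involution `σ` and has square `c`. -/
structure TwistData (A : Type*) [AddCommGroup A] where
  σ : A →+ A
  c : A
  σ_σ : ∀ a, σ (σ a) = a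
  σ_c : σ c = c

namespace TwistData

variable {A : Type*} [AddCommGroup A]

/-- The extension of `A` by `t`: here `base a` stands for `a` and `twist a` for `a * t`. -/
inductive Ext (T : TwistData A) : Type _
  | base : A → Ext T
  | twist : A → Ext T

namespace Ext

variable {T : TwistData A}

instance : Mul T.Ext where
  mul
    | base a, base b => base (a + b)
    | base a, twist b => twist (a + b)
    | twist a, base b => twist (a + T.σ b)
    | twist a, twist b => base (a + T.σ b + T.c)

instance : One T.Ext := ⟨base 0⟩

instance : Inv T.Ext where
  inv
    | base a => base (-a)
    | twist a => twist (-T.σ a - T.c)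

theorem one_def : (1 : T.Ext) = base 0 := rfl

theorem base_mul_base (a b : A) : (base a * base b : T.Ext) = base (a + b) := rfl

theorem base_mul_twist (a b : A) : (base a * twist b : T.Ext) = twist (a + b) := rfl

theorem twist_mul_base (a b : A) : (twist a * base b : T.Ext) = twist (a + T.σ b) := rfl

theorem twist_mul_twist (a b : A) : (twist a * twist b : T.Ext) = base (a + T.σ b + T.c) := rfl

theorem base_inv (a : A) : (base a : T.Ext)⁻¹ = base (-a) := rfl

theorem twist_inv (a : A) : (twist a : T.Ext)⁻¹ = twist (-T.σ a - T.c) := rfl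

instance : Group T.Ext where
  mul_assoc := by
    rintro (a | a) (b | b) (c | c) <;>
      simp only [base_mul_base, base_mul_twist, twist_mul_base, twist_mul_twist, map_add, T.σ_σ,
        T.σ_c] <;> congr 1 <;> abel
  one_mul := by
    rintro (a | a) <;> simp only [one_def, base_mul_base, base_mul_twist, zero_add]
  mul_one := by
    rintro (a | a) <;> simp only [one_def, base_mul_base, twist_mul_base, map_zero, add_zero]
  inv_mul_cancel := by
    rintro (a | a) <;> simp only [one_def, base_inv, twist_inv, base_mul_base, twist_mul_twist] <;>
      congr 1 <;> abel

instance [Finite A] : Finite T.Ext :=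
  Finite.of_surjective (Sum.elim base twist) (by rintro (a | a) <;> simp)

end Ext

variable (T : TwistData A)

/-- The endomorphism `σ - 1` of `A`. It maps `a` to the commutator of `t` and `a`, so its range is
the commutator subgroup of the extension and its kernel consists of the central elements of `A`. -/
def δ : A →+ A := T.σ - AddMonoidHom.id A

theorem δ_apply (a : A) : T.δ a = T.σ a - a := rfl

theorem δ_σ (a : A) : T.δ (T.σ a) = -T.δ a := by
  rw [δ_apply, δ_apply, T.σ_σ, neg_sub]

theorem δ_eq_zero_iff_of_mem_range {a : A} (ha : a ∈ T.δ.range) : T.δ a = 0 ↔ 2 • a = 0 := by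
  obtain ⟨b, rfl⟩ := ha
  have : T.δ (T.δ b) = -(2 • T.δ b) := by
    rw [T.δ_apply b, map_sub, T.δ_σ, T.δ_apply]
    abel
  rw [this, neg_eq_zero]

namespace Ext

variable {T} {a b : A}

theorem exists_iff {P : T.Ext → Prop} : (∃ g, P g) ↔ (∃ a, P (base a)) ∨ ∃ a, P (twist a) :=
  ⟨fun ⟨g, hg⟩ => by cases g with | base a => exact .inl ⟨a, hg⟩ | twist a => exact .inr ⟨a, hg⟩,
    fun h => h.elim (fun ⟨a, ha⟩ => ⟨_, ha⟩) fun ⟨a, ha⟩ => ⟨_, ha⟩⟩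

theorem isConj_base_base : IsConj (base a : T.Ext) (base b) ↔ b = a ∨ b = T.σ a := by
  rw [isConj_iff_exists_mul_eq, exists_iff]
  simp only [base_mul_base, twist_mul_base, base_mul_twist, base.injEq, twist.injEq, add_comm b,
    add_right_inj, exists_const, eq_comm]

theorem not_isConj_base_twist : ¬ IsConj (base a : T.Ext) (twist b) := by
  rw [isConj_iff_exists_mul_eq, exists_iff]
  simp only [base_mul_base, twist_mul_base, twist_mul_twist, reduceCtorEq, exists_false, or_self,
    not_false_eq_true]

theorem isConj_twist_twist : IsConj (twist a : T.Ext) (twist b) ↔ b - a ∈ T.δ.range := by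
  rw [isConj_iff_exists_mul_eq, exists_iff]
  simp only [base_mul_twist, twist_mul_base, twist_mul_twist, twist.injEq, base.injEq,
    add_left_inj, AddMonoidHom.mem_range]
  constructor
  · rintro (⟨s, hs⟩ | ⟨s, hs⟩)
    · exact ⟨-s, by rw [eq_sub_of_add_eq hs.symm, map_neg, δ_apply]; abel⟩
    · exact ⟨a - s, by rw [eq_sub_of_add_eq hs.symm, map_sub, δ_apply, δ_apply]; abel⟩
  · rintro ⟨s, hs⟩
    exact .inl ⟨-s, by rw [eq_add_of_sub_eq hs.symm, δ_apply, map_neg]; abel⟩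

theorem commute_base_base : Commute (base a : T.Ext) (base b) := by
  rw [Commute, SemiconjBy, base_mul_base, base_mul_base, add_comm]

theorem commute_base_twist : Commute (base a : T.Ext) (twist b) ↔ T.δ a = 0 := by
  rw [Commute, SemiconjBy, base_mul_twist, twist_mul_base, twist.injEq, add_comm,
    add_right_inj, T.δ_apply, sub_eq_zero, eq_comm]

theorem commute_twist_twist : Commute (twist a : T.Ext) (twist b) ↔ T.δ (a - b) = 0 := by
  rw [Commute, SemiconjBy, twist_mul_twist, twist_mul_twist, base.injEq, add_left_inj, δ_apply,
    map_sub, sub_eq_zero, sub_eq_sub_iff_add_eq_add, add_comm (T.σ a), eq_comm]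

theorem base_mem_center : (base a : T.Ext) ∈ Subgroup.center T.Ext ↔ T.δ a = 0 := by
  refine ⟨fun h => (commute_base_twist (b := 0)).1 (Subgroup.mem_center_iff.1 h _).symm,
    fun h => Subgroup.mem_center_iff.2 ?_⟩
  rintro (b | b)
  exacts [commute_base_base.symm, (commute_base_twist.2 h).symm]

theorem twist_mem_center : (twist a : T.Ext) ∈ Subgroup.center T.Ext ↔ T.δ = 0 := by
  refine ⟨fun h => AddMonoidHom.ext fun b =>
    commute_base_twist.1 (Subgroup.mem_center_iff.1 h (base b)), fun h =>
      Subgroup.mem_center_iff.2 ?_⟩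
  rintro (b | b)
  exacts [commute_base_twist.2 (by simp [h]), commute_twist_twist.2 (by simp [h])]

/-- The label of a noncentral element of the extension that determines its connected component in
the commuting conjugacy class graph: all elements of `A` get the same one. -/
def component : T.Ext → Option (A ⧸ T.δ.range ⊔ T.δ.ker)
  | base _ => none
  | twist a => some a

theorem component_eq_of_isConj : ∀ g h : T.Ext, IsConj g h → component g = component h
  | base _, base _, _ => rfl
  | base _, twist _, h => (not_isConj_base_twist h).elim
  | twist _, base _, h => (not_isConj_base_twist h.symm).elim
  | twist a, twist b, h => congrArg some <| QuotientAddGroup.eq.2 <| AddSubgroup.mem_sup_left <| by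
      rw [neg_add_eq_sub]
      exact isConj_twist_twist.1 h

theorem component_twist_eq_iff : component (twist a : T.Ext) = component (twist b) ↔
    ∃ s ∈ T.δ.range, T.δ (a - (b + s)) = 0 := by
  simp only [component, Option.some_inj, QuotientAddGroup.eq, AddSubgroup.mem_sup,
    AddMonoidHom.mem_ker]
  constructor
  · rintro ⟨s, hs, z, hz, hsz⟩
    refine ⟨-s, neg_mem hs, ?_⟩
    rw [show a - (b + -s) = -z by rw [eq_sub_of_add_eq' hsz]; abel, map_neg, hz, neg_zero]
  · rintro ⟨s, hs, hz⟩
    exact ⟨-s, neg_mem hs, -(a - (b + s)), by rw [map_neg, hz, neg_zero], by abel⟩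

theorem exists_isConj_commute_iff : ∀ g ∉ Subgroup.center T.Ext,
    ∀ h ∉ Subgroup.center T.Ext, (∃ h', IsConj h h' ∧ Commute g h') ↔ component g = component h
  | base a, _, base b, _ => iff_of_true ⟨_, IsConj.refl _, commute_base_base⟩ rfl
  | base a, ha, twist b, _ => iff_of_false (by
      rintro ⟨_ | c, hconj, hcomm⟩
      · exact not_isConj_base_twist hconj.symm
      · exact ha (base_mem_center.2 (commute_base_twist.1 hcomm))) (by simp [component])
  | twist a, _, base b, hb => iff_of_false (by
      rintro ⟨c | _, hconj, hcomm⟩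
      · rw [base_mem_center] at hb
        have hc := commute_base_twist.1 hcomm.symm
        rcases isConj_base_base.1 hconj with rfl | rfl
        · exact hb hc
        · exact hb (by rwa [T.δ_σ, neg_eq_zero] at hc)
      · exact not_isConj_base_twist hconj) (by simp [component])
  | twist a, _, twist b, _ => by
      rw [component_twist_eq_iff, exists_iff]
      simp only [mt IsConj.symm not_isConj_base_twist, false_and,
        exists_false, false_or, isConj_twist_twist, commute_twist_twist]
      refine ⟨fun ⟨c, hc, hac⟩ => ⟨c - b, hc, by rwa [add_sub_cancel]⟩, fun ⟨s, hs, has⟩ =>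
        ⟨b + s, by rwa [add_sub_cancel_left], has⟩⟩

theorem card_conjugatesOf_base (ha : T.δ a ≠ 0) : Nat.card (conjugatesOf (base a : T.Ext)) = 2 := by
  have : conjugatesOf (base a : T.Ext) = {base a, base (T.σ a)} := by
    ext (b | b)
    · simp only [conjugatesOf, Set.mem_ofPred_eq, isConj_base_base, Set.mem_insert_iff,
        Set.mem_singleton_iff, base.injEq]
    · simp only [conjugatesOf, Set.mem_ofPred_eq, not_isConj_base_twist, Set.mem_insert_iff,
        Set.mem_singleton_iff, reduceCtorEq, or_self]
  have hne : (base a : T.Ext) ≠ base (T.σ a) := fun h => ha (sub_eq_zero.2 (base.inj h).symm)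
  rw [this, Nat.card_coe_set_eq, Set.ncard_pair hne]

theorem card_conjugatesOf_twist :
    Nat.card (conjugatesOf (twist a : T.Ext)) = Nat.card T.δ.range := by
  have : conjugatesOf (twist a : T.Ext) = (fun s => twist (a + s)) '' (T.δ.range : Set A) := by
    ext (b | b)
    · simp only [conjugatesOf, Set.mem_ofPred_eq, mt IsConj.symm not_isConj_base_twist,
        Set.mem_image, reduceCtorEq, and_false, exists_false]
    · simp only [conjugatesOf, Set.mem_ofPred_eq, isConj_twist_twist, Set.mem_image, twist.injEq,
        SetLike.mem_coe]
      exact ⟨fun h => ⟨_, h, add_sub_cancel a b⟩, fun ⟨s, hs, hsb⟩ => by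
        rwa [← hsb, add_sub_cancel_left]⟩
  rw [this, Nat.card_image_of_injective fun s s' h => add_left_cancel (twist.inj h)]
  rfl

theorem card_component_eq_none [Finite A] :
    Nat.card {g : T.Ext // g ∉ Subgroup.center T.Ext ∧ component g = none} + Nat.card T.δ.ker =
      Nat.card A := by
  have : {g : T.Ext | g ∉ Subgroup.center T.Ext ∧ component g = none} =
      base '' (T.δ.ker : Set A)ᶜ := by
    ext (a | a) <;> simp [base_mem_center, component]
  rw [← Set.coe_ofPred, this, Nat.card_image_of_injective fun _ _ => base.inj, add_comm]
  exact Set.ncard_add_ncard_compl _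

theorem card_component_eq_some [Finite A] (hδ : T.δ ≠ 0) (i : A ⧸ T.δ.range ⊔ T.δ.ker) :
    Nat.card {g : T.Ext // g ∉ Subgroup.center T.Ext ∧ component g = some i} =
      Nat.card ↥(T.δ.range ⊔ T.δ.ker) := by
  obtain ⟨a, rfl⟩ := QuotientAddGroup.mk_surjective i
  have : {g : T.Ext | g ∉ Subgroup.center T.Ext ∧ component g = some (a : A ⧸ _)} =
      (fun s => twist (a - s)) '' (T.δ.range ⊔ T.δ.ker : AddSubgroup A) := by
    ext (b | b)
    · simp [component]
    · simp only [Set.mem_ofPred_eq, twist_mem_center, hδ, not_false_eq_true, true_and, component,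
        Option.some_inj, Set.mem_image, twist.injEq, SetLike.mem_coe, QuotientAddGroup.eq]
      exact ⟨fun h => ⟨_, h, by abel⟩, fun ⟨s, hs, hsb⟩ => by rwa [← hsb, neg_sub, sub_add_cancel]⟩
  rw [← Set.coe_ofPred, this,
    Nat.card_image_of_injective fun s s' h => sub_right_injective (twist.inj h)]
  rfl

theorem isClusterGraph_component [Finite A] (hδ : T.δ ≠ 0) {p q : ℕ}
    (hp : 2 * p + Nat.card T.δ.ker = Nat.card A)
    (hq : Nat.card T.δ.range * q = Nat.card ↥(T.δ.range ⊔ T.δ.ker)) :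
    IsClusterGraph (cccGraph T.Ext) (CCCVertex.lift component component_eq_of_isConj)
      fun i => i.elim p fun _ => q := by
  refine CCCVertex.isClusterGraph_lift (size := fun i => i.elim 2 fun _ => Nat.card T.δ.range) _
    exists_isConj_commute_iff ?_ ?_ ?_
  · rintro (_ | i)
    · obtain ⟨a, ha⟩ := DFunLike.ne_iff.1 hδ
      exact ⟨base a, mt base_mem_center.1 ha, rfl⟩
    · obtain ⟨a, rfl⟩ := QuotientAddGroup.mk_surjective i
      exact ⟨twist a, mt twist_mem_center.1 hδ, rfl⟩
  · rintro (a | a) ha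
    · exact card_conjugatesOf_base (mt base_mem_center.2 ha)
    · exact card_conjugatesOf_twist
  · rintro (_ | i)
    · exact Nat.add_right_cancel (hp.trans (card_component_eq_none).symm)
    · exact hq.trans (card_component_eq_some hδ i).symm

end Ext

theorem card_range_inf_ker_of_odd (h : Odd (Nat.card T.δ.range)) :
    Nat.card ↥(T.δ.range ⊓ T.δ.ker) = 1 := by
  rw [AddSubgroup.card_eq_one, eq_bot_iff]
  rintro a ⟨haR, haK⟩
  have h2 : addOrderOf a ∣ 2 := addOrderOf_dvd_of_nsmul_eq_zero <|
    (T.δ_eq_zero_iff_of_mem_range haR).1 haK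
  have hcard : addOrderOf a ∣ Nat.card T.δ.range := AddSubgroup.addOrderOf_dvd_natCard _ haR
  exact AddMonoid.addOrderOf_eq_one_iff.1 <|
    Nat.eq_one_of_dvd_coprimes h.coprime_two_left h2 hcard

theorem even_card_range_inf_ker [Finite A] (h : Even (Nat.card T.δ.range)) :
    Even (Nat.card ↥(T.δ.range ⊓ T.δ.ker)) := by
  obtain ⟨a, ha⟩ := exists_prime_addOrderOf_dvd_card' 2 h.two_dvd
  rw [← AddSubgroup.addOrderOf_coe] at ha
  have haK : T.δ a = 0 := (T.δ_eq_zero_iff_of_mem_range a.2).2 (ha ▸ addOrderOf_nsmul_eq_zero _)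
  exact even_iff_two_dvd.2 (ha ▸ AddSubgroup.addOrderOf_dvd_natCard _ ⟨a.2, haK⟩)

theorem exists_isClusterGraph [Finite A] (hδ : T.δ ≠ 0) :
    ∃ (f : CCCVertex T.Ext → Option (A ⧸ T.δ.range ⊔ T.δ.ker)) (p q : ℕ),
      IsClusterGraph (cccGraph T.Ext) f (fun i => i.elim p fun _ => q) ∧
      2 * p + Nat.card T.δ.ker = Nat.card A ∧
      Nat.card ↥(T.δ.range ⊓ T.δ.ker) * q = Nat.card T.δ.ker := by
  obtain ⟨q, hq⟩ := AddSubgroup.card_dvd_of_le (le_sup_left : T.δ.range ≤ T.δ.range ⊔ T.δ.ker)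
  have hA : Nat.card T.δ.range * Nat.card T.δ.ker = Nat.card A := by
    rw [← AddSubgroup.index_ker, mul_comm, AddSubgroup.card_mul_index]
  have hz : Nat.card ↥(T.δ.range ⊓ T.δ.ker) * q = Nat.card T.δ.ker := by
    refine Nat.eq_of_mul_eq_mul_left (Nat.card_pos (α := T.δ.range)) ?_
    rw [mul_left_comm, ← hq, hA, ← index_range_sup_ker, mul_comm, AddSubgroup.card_mul_index]
  have heven : 2 * ((Nat.card A - Nat.card T.δ.ker) / 2) = Nat.card A - Nat.card T.δ.ker := by
    refine Nat.two_mul_div_two_of_even ?_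
    rw [← hA, ← hz, ← Nat.sub_one_mul]
    rcases Nat.even_or_odd (Nat.card T.δ.range) with h | h
    · exact ((T.even_card_range_inf_ker h).mul_right q).mul_left _
    · exact (Nat.Odd.sub_odd h odd_one).mul_right _
  have hp : 2 * ((Nat.card A - Nat.card T.δ.ker) / 2) + Nat.card T.δ.ker = Nat.card A := by
    rw [heven, Nat.sub_add_cancel (Finite.card_subtype_le _)]
  exact ⟨_, _, q, Ext.isClusterGraph_component hδ hp hq.symm, hp, hz⟩

theorem clique_sizes_dichotomy {d r q p : ℕ} (hd : 2 ≤ d) (hq : 1 ≤ q) (hrd : r ∣ d)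
    (hodd : Odd d → r = 1) (heven : Even d → Even r) (hp : 2 * p + r * q = d * (r * q)) :
    ((p = q ∨ p = 2 ∧ q = 1) ∧ (d = 2 ∨ d = 3 ∨ d * (r * q) = 5)) ∨
      (3 ≤ p ∧ (r + 1) * q ≤ p) ∧ ¬ (d = 2 ∨ d = 3 ∨ d * (r * q) = 5) := by
  rcases Nat.even_or_odd d with he | ho
  · have hr : 2 ≤ r := by
      have := Nat.pos_of_dvd_of_pos hrd (by omega)
      obtain ⟨k, rfl⟩ := heven he
      omega
    obtain rfl | hd4 : d = 2 ∨ 4 ≤ d := by obtain ⟨k, rfl⟩ := he; omega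
    · obtain rfl : r = 2 := le_antisymm (Nat.le_of_dvd two_pos hrd) hr
      omega
    · have hrq : 2 * q ≤ r * q := Nat.mul_le_mul_right q hr
      have hdrq : 4 * (r * q) ≤ d * (r * q) := Nat.mul_le_mul_right _ hd4
      rw [add_one_mul]
      omega
  · obtain rfl := hodd ho
    rw [one_mul] at *
    obtain rfl | rfl | hd : d = 3 ∨ d = 5 ∨ 7 ≤ d := by obtain ⟨k, rfl⟩ := ho; omega
    · omega
    · omega
    · have := Nat.mul_le_mul_right q hd
      omega

variable {T} in
theorem cnEnergies_iff [Finite A] {G : Type*} [Group G] [Finite G] (e : G ≃* T.Ext) {d N : ℕ}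
    {P : Prop} (hd : Nat.card T.δ.range = d) (hN : Nat.card A = N) (hd2 : 2 ≤ d)
    (hP : d = 2 ∨ d = 3 ∨ N = 5 ↔ P) :
    (CNEnergiesEqual G ↔ P) ∧ (CNEnergiesIncreasing G ↔ ¬ P) := by
  have hδ : T.δ ≠ 0 := fun h => by
    rw [AddMonoidHom.range_eq_bot_iff.2 h, AddSubgroup.card_bot] at hd
    omega
  obtain ⟨f, p, q, hf, hp, hz⟩ := T.exists_isClusterGraph hδ
  have hA : d * Nat.card T.δ.ker = N := by
    rw [← hd, ← hN, ← AddSubgroup.index_ker, mul_comm, AddSubgroup.card_mul_index]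
  have hΓ := hf.comp_iso (cccGraphIso e)
  have : Nonempty (CCCVertex G) := (hΓ.surjective none).nonempty
  have := Fintype.ofFinite (A ⧸ T.δ.range ⊔ T.δ.ker)
  have hr : Nat.card ↥(T.δ.range ⊓ T.δ.ker) = Fintype.card (A ⧸ T.δ.range ⊔ T.δ.ker) := by
    rw [← index_range_sup_ker, AddSubgroup.index, Nat.card_eq_fintype_card]
  have hq : 1 ≤ q := Nat.pos_of_ne_zero (right_ne_zero_of_mul (hz ▸ Nat.card_pos.ne'))
  rw [← hP]
  obtain ⟨hpq, hcond⟩ | ⟨⟨hp3, hrq⟩, hcond⟩ := clique_sizes_dichotomy hd2 hq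
    (hd ▸ AddSubgroup.card_dvd_of_le inf_le_left)
    (fun h => T.card_range_inf_ker_of_odd (hd ▸ h)) (fun h => T.even_card_range_inf_ker (hd ▸ h))
    (by rw [hz, hp, hA, hN])
  · have heq : CNEnergiesEqual G := hΓ.cnEnergies_eq (c := ((q : ℝ) - 1) * ((q : ℝ) - 2)) <| by
      rintro (_ | _)
      · rcases hpq with rfl | ⟨rfl, rfl⟩ <;> simp
      · rfl
    rw [hz, hA] at hcond
    exact ⟨iff_of_true heq hcond, iff_of_false (fun h => h.1.ne heq.1) (not_not.2 hcond)⟩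
  · have hlt : CNEnergiesIncreasing G := hΓ.cnEnergies_lt hp3 hq (hr ▸ hrq)
    rw [hz, hA] at hcond
    exact ⟨iff_of_false (fun h => hlt.1.ne h.1) hcond, iff_of_true hlt hcond⟩

variable {T}

theorem card_range_δ_eq_addOrderOf {ρ a₀ : A} (hρ : T.δ a₀ = ρ)
    (hgen : ∀ a, ∃ k : ℤ, k • ρ = T.δ a) : Nat.card T.δ.range = addOrderOf ρ := by
  have : T.δ.range = AddSubgroup.zmultiples ρ := by
    refine le_antisymm ?_ ((AddSubgroup.zmultiples_le_of_mem ⟨a₀, hρ⟩))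
    rintro _ ⟨a, rfl⟩
    exact AddSubgroup.mem_zmultiples_iff.2 (hgen a)
  rw [this, Nat.card_zmultiples]

namespace Ext

variable {G : Type*} [Group G]

theorem base_zpow (a : A) (k : ℤ) : (base a : T.Ext) ^ k = base (k • a) :=
  (map_zpow (MonoidHom.mk' (fun a : Multiplicative A => (base a.toAdd : T.Ext))
    fun _ _ => rfl) (.ofAdd a) k).symm

theorem base_pow (a : A) (k : ℕ) : (base a : T.Ext) ^ k = base (k • a) := by
  rw [← zpow_natCast, base_zpow, natCast_zsmul]

theorem closure_eq_top {S : Set T.Ext} (hbase : ∀ a, base a ∈ Subgroup.closure S)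
    (htwist : twist 0 ∈ Subgroup.closure S) : Subgroup.closure S = ⊤ := by
  refine (Subgroup.eq_top_iff' _).2 ?_
  rintro (a | a)
  · exact hbase a
  · rw [← add_zero a, ← base_mul_twist]
    exact mul_mem (hbase a) htwist

/-- The homomorphism out of the extension given by its values `φ` on `A` and `t` on the adjoined
element. -/
def lift (φ : A →+ Additive G) (t : G) (hσ : ∀ a, t * (φ a).toMul = (φ (T.σ a)).toMul * t)
    (hc : t * t = (φ T.c).toMul) : T.Ext →* G :=
  MonoidHom.mk' (fun
    | base a => (φ a).toMul
    | twist a => (φ a).toMul * t) <| by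
  rintro (a | a) (b | b)
  · simp only [map_add, toMul_add]
  · simp only [map_add, toMul_add, mul_assoc]
  · simp only [map_add, toMul_add, mul_assoc, hσ]
  · calc (φ (a + T.σ b + T.c)).toMul = (φ a).toMul * ((φ (T.σ b)).toMul * t) * t := by
          simp only [map_add, toMul_add, ← hc, mul_assoc]
      _ = (φ a).toMul * t * ((φ b).toMul * t) := by simp only [← hσ, mul_assoc]

theorem lift_base {φ : A →+ Additive G} {t : G}
    (hσ : ∀ a, t * (φ a).toMul = (φ (T.σ a)).toMul * t) (hc : t * t = (φ T.c).toMul) (a : A) :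
    lift φ t hσ hc (base a) = (φ a).toMul := rfl

theorem lift_twist_zero {φ : A →+ Additive G} {t : G}
    (hσ : ∀ a, t * (φ a).toMul = (φ (T.σ a)).toMul * t) (hc : t * t = (φ T.c).toMul) :
    lift φ t hσ hc (twist 0) = t :=
  show (φ 0).toMul * t = t by rw [map_zero, toMul_zero, one_mul]

end Ext

/-- The extension of `A` by an element that acts on `A` by inversion. -/
@[simps]
def inversion (c : A) (hc : -c = c) : TwistData A where
  σ := -AddMonoidHom.id A
  c := c
  σ_σ := neg_neg
  σ_c := hc

theorem card_range_δ_inversion {N : ℕ} [NeZero N] (c : ZMod N) (hc : -c = c) :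
    Nat.card (inversion c hc).δ.range = N / N.gcd 2 := by
  have hδ (a : ZMod N) : (inversion c hc).δ a = -(2 * a) := by
    rw [δ_apply, two_mul]
    exact (neg_add' a a).symm
  rw [card_range_δ_eq_addOrderOf (ρ := -2) (a₀ := 1) (by simp [hδ])]
  · rw [addOrderOf_neg, ← Nat.cast_two, ZMod.addOrderOf_coe _ (NeZero.ne N)]
  · intro a
    obtain ⟨k, rfl⟩ := ZMod.intCast_surjective a
    exact ⟨k, by rw [hδ, zsmul_eq_mul, mul_comm, neg_mul]⟩

/-- The dihedral group, with `twist 0` the reflection `sr 0`. -/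
def dihedralEquiv (n : ℕ) : DihedralGroup n ≃* (inversion (0 : ZMod n) neg_zero).Ext where
  toFun
    | .r a => .base a
    | .sr a => .twist (-a)
  invFun
    | .base a => .r a
    | .twist a => .sr (-a)
  left_inv := by rintro (a | a) <;> simp
  right_inv := by rintro (a | a) <;> simp
  map_mul' := by
    rintro (a | a) (b | b) <;>
      simp [Ext.base_mul_base, Ext.base_mul_twist, Ext.twist_mul_base, Ext.twist_mul_twist,
        sub_eq_add_neg, add_comm]

theorem neg_natCast_half (n : ℕ) : -(n : ZMod (2 * n)) = n := by
  rw [neg_eq_iff_add_eq_zero, ← two_mul]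
  exact_mod_cast ZMod.natCast_self (2 * n)

/-- The dicyclic group, with `twist 0` the element `xa 0`. -/
def quaternionEquiv (n : ℕ) :
    QuaternionGroup n ≃* (inversion (n : ZMod (2 * n)) (neg_natCast_half n)).Ext where
  toFun
    | .a a => .base a
    | .xa a => .twist (-a)
  invFun
    | .base a => .a a
    | .twist a => .xa (-a)
  left_inv := by rintro (a | a) <;> simp
  right_inv := by rintro (a | a) <;> simp
  map_mul' := by
    rintro (a | a) (b | b) <;>
      simp [Ext.base_mul_base, Ext.base_mul_twist, Ext.twist_mul_base, Ext.twist_mul_twist,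
        sub_eq_add_neg, add_comm, add_left_comm, add_assoc]

end TwistData

section PowHom

variable {G : Type*} [Group G]

/-- The homomorphism `k ↦ g ^ k` on `ZMod N`, for an element `g` of order dividing `N`. -/
def zmodPowHom {N : ℕ} (g : G) (hg : g ^ N = 1) : ZMod N →+ Additive G :=
  ZMod.lift N ⟨zmultiplesHom (Additive G) (.ofMul g), by
    rw [zmultiplesHom_apply, natCast_zsmul, ← ofMul_pow, hg, ofMul_one]⟩

theorem toMul_zmodPowHom_intCast {N : ℕ} {g : G} (hg : g ^ N = 1) (k : ℤ) :
    (zmodPowHom g hg k).toMul = g ^ k := by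
  simp [zmodPowHom]

/-- The homomorphism `(k, l) ↦ g ^ k * h ^ l` on `ZMod M × ZMod N`, for commuting elements `g` and
`h` of orders dividing `M` and `N`. -/
def zmodProdPowHom {M N : ℕ} {g h : G} (hg : g ^ M = 1) (hh : h ^ N = 1) (hgh : Commute g h) :
    ZMod M × ZMod N →+ Additive G :=
  (zmodPowHom g hg).noncommCoprod (zmodPowHom h hh) fun k l => by
    obtain ⟨k, rfl⟩ := ZMod.intCast_surjective k
    obtain ⟨l, rfl⟩ := ZMod.intCast_surjective l
    rw [addCommute_iff_eq]
    apply Additive.toMul.injective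
    rw [toMul_add, toMul_add, toMul_zmodPowHom_intCast, toMul_zmodPowHom_intCast]
    exact (hgh.zpow_zpow k l).eq

theorem toMul_zmodProdPowHom_intCast {M N : ℕ} {g h : G} (hg : g ^ M = 1) (hh : h ^ N = 1)
    (hgh : Commute g h) (k l : ℤ) :
    (zmodProdPowHom hg hh hgh (k, l)).toMul = g ^ k * h ^ l := by
  simp only [zmodProdPowHom, AddMonoidHom.noncommCoprod_apply, toMul_add,
    toMul_zmodPowHom_intCast]

end PowHom

namespace GroupFamilies

open TwistData TwistData.Ext

theorem nonempty_mulEquiv_of_generators {H : Type*} [Group H] {rels : Set (FreeGroup (Fin 2))}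
    {u v : H} (hrels : ∀ r ∈ rels, FreeGroup.lift ![u, v] r = 1)
    (hgen : Subgroup.closure {u, v} = ⊤)
    (hψ : ∃ ψ : H →* PresentedGroup rels,
      ψ u = PresentedGroup.mk rels x ∧ ψ v = PresentedGroup.mk rels y) :
    Nonempty (PresentedGroup rels ≃* H) := by
  obtain ⟨ψ, hu, hv⟩ := hψ
  have hx : PresentedGroup.toGroup hrels (PresentedGroup.mk rels x) = u :=
    PresentedGroup.toGroup.of hrels
  have hy : PresentedGroup.toGroup hrels (PresentedGroup.mk rels y) = v :=
    PresentedGroup.toGroup.of hrels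
  refine ⟨(PresentedGroup.toGroup hrels).toMulEquiv ψ ?_ ?_⟩
  · refine MonoidHom.eq_of_eqOn_dense (closure_of rels) ?_
    rintro _ (rfl | rfl)
    · exact (congrArg ψ hx).trans hu
    · exact (congrArg ψ hy).trans hv
  · refine MonoidHom.eq_of_eqOn_dense hgen ?_
    rintro _ (rfl | rfl)
    · exact (congrArg _ hu).trans hx
    · exact (congrArg _ hv).trans hy

variable {G : Type*} [Group G] {a b : G} {n m : ℕ}

section U

/-- The data exhibiting `U_(n,m)` as an extension by `x` of its subgroup generated by `x ^ 2` and
`y`. -/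
def twistU (n m : ℕ) : TwistData (ZMod n × ZMod m) where
  σ := (AddMonoidHom.id _).prodMap (-AddMonoidHom.id _)
  c := (1, 0)
  σ_σ := by rintro ⟨k, l⟩; simp
  σ_c := by simp

theorem twistU_σ (k : ZMod n) (l : ZMod m) : (twistU n m).σ (k, l) = (k, -l) := rfl

theorem twistU_c : (twistU n m).c = (1, 0) := rfl

theorem exists_hom_twistU (ha : a ^ (2 * n) = 1) (hb : b ^ m = 1) (hab : a⁻¹ * b * a = b⁻¹) :
    ∃ ψ : (twistU n m).Ext →* G, ψ (twist 0) = a ∧ ψ (base (0, 1)) = b := by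
  have hinv : SemiconjBy a b⁻¹ b := by rw [SemiconjBy, ← hab]; group
  have hinv' : SemiconjBy a b b⁻¹ := by simpa only [inv_inv] using hinv.inv_right
  have hcomm : Commute (a ^ 2) b := sq a ▸ hinv.mul_left hinv'
  have hφ := toMul_zmodProdPowHom_intCast (M := n) (by rw [← pow_mul, ha]) hb hcomm
  refine ⟨Ext.lift (zmodProdPowHom (by rw [← pow_mul, ha]) hb hcomm) a ?_ ?_,
    lift_twist_zero _ _, ?_⟩
  · rintro ⟨k, l⟩
    obtain ⟨k, rfl⟩ := ZMod.intCast_surjective k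
    obtain ⟨l, rfl⟩ := ZMod.intCast_surjective l
    have hl : SemiconjBy a (b ^ l) (b ^ (-l)) := by
      simpa only [inv_zpow'] using hinv'.zpow_right l
    rw [twistU_σ, ← Int.cast_neg, hφ, hφ]
    exact (SemiconjBy.mul_right ((Commute.self_pow a 2).zpow_right k) hl).eq
  · rw [twistU_c]
    simpa [sq] using (hφ 1 0).symm
  · rw [lift_base]
    simpa using hφ 0 1

theorem twist_zero_sq_U : (twist 0 : (twistU n m).Ext) ^ 2 = base (1, 0) := by
  simp [sq, twist_mul_twist, twistU_c]

theorem closure_twistU :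
    Subgroup.closure {(twist 0 : (twistU n m).Ext), base (0, 1)} = ⊤ := by
  have htwist := Subgroup.subset_closure
    (Set.mem_insert (twist 0 : (twistU n m).Ext) {base (0, 1)})
  have hbase := Subgroup.subset_closure
    (Set.mem_insert_of_mem (twist 0 : (twistU n m).Ext) (Set.mem_singleton (base (0, 1))))
  refine closure_eq_top ?_ htwist
  rintro ⟨k, l⟩
  obtain ⟨k, rfl⟩ := ZMod.intCast_surjective k
  obtain ⟨l, rfl⟩ := ZMod.intCast_surjective l
  have : (base (k, l) : (twistU n m).Ext) = (twist 0 ^ 2) ^ k * base (0, 1) ^ l := by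
    simp [twist_zero_sq_U, base_zpow, base_mul_base]
  rw [this]
  exact mul_mem (zpow_mem (pow_mem htwist 2) k) (zpow_mem hbase l)

theorem nonempty_mulEquiv_U (n m : ℕ) : Nonempty (U n m ≃* (twistU n m).Ext) := by
  refine nonempty_mulEquiv_of_generators ?_ closure_twistU (exists_hom_twistU ?_ ?_ ?_)
  · rintro r (rfl | rfl | rfl)
    · simp [x, pow_mul, twist_zero_sq_U, base_pow, one_def]
    · simp [y, base_pow, one_def]
    · simp [x, y, twist_inv, twist_mul_base, twist_mul_twist, base_mul_base, one_def, twistU_σ,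
        twistU_c]
  · exact PresentedGroup.one_of_mem (x := x ^ (2 * n)) (by simp [relsU])
  · exact PresentedGroup.one_of_mem (x := y ^ m) (by simp [relsU])
  · exact PresentedGroup.mk_eq_mk_of_mul_inv_mem (x := x⁻¹ * y * x) (y := y⁻¹) (by simp [relsU])

theorem card_range_δ_twistU [NeZero m] : Nat.card (twistU n m).δ.range = m / m.gcd 2 := by
  have hδ (k : ZMod n) (l : ZMod m) : (twistU n m).δ (k, l) = (0, -(2 * l)) := by
    rw [δ_apply, twistU_σ, Prod.mk_sub_mk, sub_self, two_mul, neg_add']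
  rw [card_range_δ_eq_addOrderOf (ρ := (0, -2)) (a₀ := (0, 1)) (by simp [hδ])]
  · rw [Prod.addOrderOf_mk, addOrderOf_zero, Nat.lcm_one_left, addOrderOf_neg, ← Nat.cast_two,
      ZMod.addOrderOf_coe _ (NeZero.ne m)]
  · rintro ⟨k, l⟩
    obtain ⟨l, rfl⟩ := ZMod.intCast_surjective l
    exact ⟨l, by simp [hδ, mul_comm]⟩

end U

section SD

/-- The data exhibiting `SD_{8n}` as an extension by `y` of its subgroup generated by `x`. -/
def twistSD (n : ℕ) : TwistData (ZMod (4 * n)) where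
  σ := AddMonoidHom.mulLeft (2 * n - 1)
  c := 0
  σ_σ a := by
    have h : (4 * n : ZMod (4 * n)) = 0 := by exact_mod_cast ZMod.natCast_self (4 * n)
    simp only [AddMonoidHom.coe_mulLeft]
    linear_combination (n - 1) * a * h
  σ_c := by simp

theorem twistSD_σ (k : ZMod (4 * n)) : (twistSD n).σ k = (2 * n - 1) * k := rfl

theorem twistSD_c : (twistSD n).c = 0 := rfl

theorem exists_hom_twistSD [NeZero n] (ha : a ^ (4 * n) = 1) (hb : b ^ 2 = 1)
    (hab : b * a * b = a ^ (2 * n - 1)) :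
    ∃ ψ : (twistSD n).Ext →* G, ψ (base 1) = a ∧ ψ (twist 0) = b := by
  have hsemi : SemiconjBy b a (a ^ (2 * n - 1)) := by
    rw [SemiconjBy, ← hab, mul_assoc _ b b, ← sq, hb, mul_one]
  have hφ := toMul_zmodPowHom_intCast ha
  refine ⟨Ext.lift (zmodPowHom a ha) b ?_ ?_, ?_, lift_twist_zero _ _⟩
  · intro k
    obtain ⟨k, rfl⟩ := ZMod.intCast_surjective k
    have hcast : (2 * n - 1) * (k : ZMod (4 * n)) = ((2 * n - 1 : ℕ) * k : ℤ) := by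
      rw [Int.cast_mul, Int.cast_natCast, Nat.cast_pred (by have := NeZero.pos n; omega)]
      push_cast
      rfl
    rw [twistSD_σ, hcast, hφ, hφ, zpow_mul, zpow_natCast]
    exact (hsemi.zpow_right k).eq
  · rw [twistSD_c, map_zero, toMul_zero, ← sq, hb]
  · rw [lift_base]
    simpa using hφ 1

theorem closure_twistSD : Subgroup.closure {(base 1 : (twistSD n).Ext), twist 0} = ⊤ := by
  refine closure_eq_top (fun k => ?_) (Subgroup.subset_closure (by simp))
  obtain ⟨k, rfl⟩ := ZMod.intCast_surjective k
  have : (base k : (twistSD n).Ext) = base 1 ^ k := by simp [base_zpow]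
  rw [this]
  exact zpow_mem (Subgroup.subset_closure (by simp)) k

theorem nonempty_mulEquiv_SD (n : ℕ) [NeZero n] : Nonempty (SD n ≃* (twistSD n).Ext) := by
  refine nonempty_mulEquiv_of_generators ?_ closure_twistSD (exists_hom_twistSD ?_ ?_ ?_)
  · have hcast : ((2 * n - 1 : ℕ) : ZMod (4 * n)) = 2 * n - 1 := by
      rw [Nat.cast_pred (by have := NeZero.pos n; omega)]
      push_cast
      rfl
    rintro r (rfl | rfl | rfl)
    · simp [x, base_pow, one_def, -nsmul_eq_mul]
    · simp [y, sq, twist_mul_twist, one_def, twistSD_c]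
    · simp [x, y, base_pow, base_inv, twist_mul_base, twist_mul_twist, base_mul_base, one_def,
        twistSD_σ, twistSD_c, hcast]
  · exact PresentedGroup.one_of_mem (x := x ^ (4 * n)) (by simp [relsSD])
  · exact PresentedGroup.one_of_mem (x := y ^ 2) (by simp [relsSD])
  · exact PresentedGroup.mk_eq_mk_of_mul_inv_mem (x := y * x * y) (y := x ^ (2 * n - 1))
      (by simp [relsSD])

theorem card_range_δ_twistSD [NeZero n] :
    Nat.card (twistSD n).δ.range = 2 * n / (n - 1).gcd 2 := by
  have hcast : ((2 * (n - 1) : ℕ) : ZMod (4 * n)) = 2 * n - 1 - 1 := by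
    rw [Nat.cast_mul, Nat.cast_pred (NeZero.pos n)]
    push_cast
    ring
  have hδ (k : ZMod (4 * n)) : (twistSD n).δ k = k * (2 * (n - 1) : ℕ) := by
    rw [δ_apply, twistSD_σ, hcast]
    ring
  have hgcd : (4 * n).gcd (2 * (n - 1)) = 2 * (n - 1).gcd 2 := by
    obtain ⟨k, hk⟩ := Nat.exists_eq_add_one_of_ne_zero (NeZero.ne n)
    rw [show 4 * n = 2 * (2 * k + 2) by omega, Nat.gcd_mul_left, hk, Nat.add_sub_cancel,
      Nat.gcd_comm, Nat.gcd_mul_right_add_right]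
  rw [card_range_δ_eq_addOrderOf (a₀ := 1) ((hδ 1).trans (one_mul _)),
    ZMod.addOrderOf_coe _ (NeZero.ne (4 * n)), hgcd, show 4 * n = 2 * (2 * n) by omega,
    Nat.mul_div_mul_left _ _ two_pos]
  intro k
  obtain ⟨k, rfl⟩ := ZMod.intCast_surjective k
  exact ⟨k, by rw [hδ, zsmul_eq_mul]⟩

end SD

section V

/-- The data exhibiting `V_{8n}` as an extension by `y` of its subgroup generated by `x` and
`y ^ 2`. -/
def twistV (n : ℕ) : TwistData (ZMod (2 * n) × ZMod 2) where
  σ := (-AddMonoidHom.fst _ _).prod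
    ((ZMod.castHom (dvd_mul_right 2 n) (ZMod 2)).toAddMonoidHom.coprod (AddMonoidHom.id _))
  c := (0, 1)
  σ_σ := by
    rintro ⟨k, l⟩
    simp [-ZMod.castHom_apply, CharTwo.add_cancel_left]
  σ_c := by simp

theorem twistV_σ (k : ZMod (2 * n)) (l : ZMod 2) :
    (twistV n).σ (k, l) = (-k, ZMod.castHom (dvd_mul_right 2 n) (ZMod 2) k + l) := rfl

theorem twistV_c : (twistV n).c = (0, 1) := rfl

theorem commute_sq_of_relsV (hb : b ^ 4 = 1) (hab : b * a = a⁻¹ * b⁻¹)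
    (hab' : b⁻¹ * a = a⁻¹ * b) : Commute a (b ^ 2) := by
  have hinv : b * a⁻¹ = a * b⁻¹ := by
    calc b * a⁻¹ = b * (a⁻¹ * b) * b⁻¹ := by group
      _ = a * b⁻¹ := by rw [← hab']; group
  have hsq : (b ^ 2)⁻¹ = b ^ 2 := by
    rw [inv_eq_iff_mul_eq_one, ← pow_add, hb]
  have : b ^ 2 * a = a * b ^ 2 := by
    calc b ^ 2 * a = b * a⁻¹ * b⁻¹ := by rw [sq, mul_assoc, hab, mul_assoc]
      _ = a * (b ^ 2)⁻¹ := by rw [hinv, mul_assoc, ← mul_inv_rev, sq]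
      _ = a * b ^ 2 := by rw [hsq]
  exact this.symm

theorem exists_hom_twistV (ha : a ^ (2 * n) = 1) (hb : b ^ 4 = 1) (hab : b * a = a⁻¹ * b⁻¹)
    (hab' : b⁻¹ * a = a⁻¹ * b) :
    ∃ ψ : (twistV n).Ext →* G, ψ (base (1, 0)) = a ∧ ψ (twist 0) = b := by
  have hcomm := commute_sq_of_relsV hb hab hab'
  have hb2 : (b ^ 2) ^ 2 = 1 := by rw [← pow_mul, hb]
  have hsemi : SemiconjBy b a (a⁻¹ * b ^ 2) := by
    have : b⁻¹ = b ^ 2 * b := by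
      rw [inv_eq_iff_mul_eq_one, ← pow_succ, ← pow_succ', hb]
    rw [SemiconjBy, hab, this, mul_assoc]
  have hφ := toMul_zmodProdPowHom_intCast ha hb2 hcomm
  refine ⟨Ext.lift (zmodProdPowHom ha hb2 hcomm) b ?_ ?_, ?_, lift_twist_zero _ _⟩
  · rintro ⟨k, l⟩
    obtain ⟨k, rfl⟩ := ZMod.intCast_surjective k
    obtain ⟨l, rfl⟩ := ZMod.intCast_surjective l
    have hk : (a⁻¹ * b ^ 2) ^ k = a ^ (-k) * (b ^ 2) ^ k := by
      rw [hcomm.inv_left.mul_zpow, inv_zpow']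
    rw [twistV_σ, map_intCast, ← Int.cast_neg, ← Int.cast_add, hφ, hφ, zpow_add,
      ← mul_assoc (a ^ (-k)), ← hk]
    exact ((hsemi.zpow_right k).mul_right ((Commute.self_pow b 2).zpow_right l)).eq
  · rw [twistV_c]
    simpa [sq] using (hφ 0 1).symm
  · rw [lift_base]
    simpa using hφ 1 0

theorem twist_zero_sq_V : (twist 0 : (twistV n).Ext) ^ 2 = base (0, 1) := by
  simp [sq, twist_mul_twist, twistV_c]

theorem closure_twistV :
    Subgroup.closure {(base (1, 0) : (twistV n).Ext), twist 0} = ⊤ := by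
  have hbase := Subgroup.subset_closure
    (Set.mem_insert (base (1, 0) : (twistV n).Ext) {twist 0})
  have htwist := Subgroup.subset_closure
    (Set.mem_insert_of_mem (base (1, 0) : (twistV n).Ext) (Set.mem_singleton (twist 0)))
  refine closure_eq_top ?_ htwist
  rintro ⟨k, l⟩
  obtain ⟨k, rfl⟩ := ZMod.intCast_surjective k
  obtain ⟨l, rfl⟩ := ZMod.intCast_surjective l
  have : (base (k, l) : (twistV n).Ext) = base (1, 0) ^ k * (twist 0 ^ 2) ^ l := by
    simp [twist_zero_sq_V, base_zpow, base_mul_base]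
  rw [this]
  exact mul_mem (zpow_mem hbase k) (zpow_mem (pow_mem htwist 2) l)

theorem nonempty_mulEquiv_V (n : ℕ) : Nonempty (V n ≃* (twistV n).Ext) := by
  refine nonempty_mulEquiv_of_generators ?_ closure_twistV (exists_hom_twistV ?_ ?_ ?_ ?_)
  · rintro r (rfl | rfl | rfl | rfl)
    · simp [x, base_pow, one_def]
    · have : (twist 0 : (twistV n).Ext) ^ 4 = 1 := by
        rw [show 4 = 2 * 2 from rfl, pow_mul, twist_zero_sq_V, base_pow]
        simp [one_def, CharTwo.two_eq_zero]
      simpa [y] using this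
    · simp [x, y, twist_mul_base, twist_mul_twist, one_def, twistV_σ,
        CharTwo.add_self_eq_zero, twistV_c, -ZMod.castHom_apply]
    · simp [x, y, twist_inv, twist_mul_base, twist_mul_twist, one_def, twistV_σ,
        CharTwo.add_self_eq_zero, twistV_c, -ZMod.castHom_apply]
  · exact PresentedGroup.one_of_mem (x := x ^ (2 * n)) (by simp [relsV])
  · exact PresentedGroup.one_of_mem (x := y ^ 4) (by simp [relsV])
  · exact PresentedGroup.mk_eq_mk_of_mul_inv_mem (x := y * x) (y := x⁻¹ * y⁻¹) (by simp [relsV])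
  · exact PresentedGroup.mk_eq_mk_of_mul_inv_mem (x := y⁻¹ * x) (y := x⁻¹ * y) (by simp [relsV])

theorem card_range_δ_twistV [NeZero n] : Nat.card (twistV n).δ.range = n.lcm 2 := by
  have hδ (k : ZMod (2 * n)) (l : ZMod 2) :
      (twistV n).δ (k, l) = (-(2 * k), ZMod.castHom (dvd_mul_right 2 n) (ZMod 2) k) := by
    rw [δ_apply, twistV_σ, Prod.mk_sub_mk, add_sub_cancel_right, ← neg_add', ← two_mul k]
  have horder : addOrderOf (2 : ZMod (2 * n)) = n := by
    have := ZMod.addOrderOf_coe 2 (NeZero.ne (2 * n))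
    rwa [Nat.cast_two, Nat.gcd_mul_right_left, Nat.mul_div_cancel_left n two_pos] at this
  rw [card_range_δ_eq_addOrderOf (ρ := (-2, 1)) (a₀ := (1, 0)) (by rw [hδ, mul_one, map_one])]
  · rw [Prod.addOrderOf_mk, addOrderOf_neg, horder, ZMod.addOrderOf_one]
  · rintro ⟨k, l⟩
    obtain ⟨k, rfl⟩ := ZMod.intCast_surjective k
    exact ⟨k, by rw [hδ, map_intCast]; simp [mul_comm]⟩

end V

end GroupFamilies

theorem gcd_two_eq_one_or_two (n : ℕ) :
    n % 2 = 0 ∧ n.gcd 2 = 2 ∨ n % 2 = 1 ∧ n.gcd 2 = 1 := by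
  rw [Nat.gcd_comm, Nat.gcd_rec]
  rcases Nat.mod_two_eq_zero_or_one n with h | h <;> simp [h]

namespace GroupFamilies

open TwistData

theorem cnEnergies_dihedralGroup_iff {n : ℕ} [NeZero n] (hn : 3 ≤ n) :
    (CNEnergiesEqual (DihedralGroup n) ↔ n = 3 ∨ n = 4 ∨ n = 5 ∨ n = 6) ∧
      (CNEnergiesIncreasing (DihedralGroup n) ↔ ¬ (n = 3 ∨ n = 4 ∨ n = 5 ∨ n = 6)) := by
  obtain ⟨h2, hgcd⟩ | ⟨h2, hgcd⟩ := gcd_two_eq_one_or_two n <;>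
    exact cnEnergies_iff (dihedralEquiv n) (hgcd ▸ card_range_δ_inversion _ _) (Nat.card_zmod n)
      (by omega) (by omega)

theorem cnEnergies_quaternionGroup_iff {n : ℕ} [NeZero n] (hn : 2 ≤ n) :
    (CNEnergiesEqual (QuaternionGroup n) ↔ n = 2 ∨ n = 3) ∧
      (CNEnergiesIncreasing (QuaternionGroup n) ↔ ¬ (n = 2 ∨ n = 3)) :=
  cnEnergies_iff (quaternionEquiv n) ((card_range_δ_inversion _ _).trans (by simp))
    (Nat.card_zmod _) hn (by omega)

theorem cnEnergies_U_iff {n m : ℕ} [NeZero n] [NeZero m] (hn : 2 ≤ n) (hm : 3 ≤ m) :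
    (CNEnergiesEqual (U n m) ↔ m = 3 ∨ m = 4 ∨ m = 6) ∧
      (CNEnergiesIncreasing (U n m) ↔ ¬ (m = 3 ∨ m = 4 ∨ m = 6)) := by
  obtain ⟨e⟩ := nonempty_mulEquiv_U n m
  have hN : Nat.card (ZMod n × ZMod m) = n * m := by
    rw [Nat.card_prod, Nat.card_zmod, Nat.card_zmod]
  have hnm : n * m ≠ 5 := ((Nat.mul_le_mul hn hm).trans_lt' (by norm_num)).ne'
  obtain ⟨h2, hgcd⟩ | ⟨h2, hgcd⟩ := gcd_two_eq_one_or_two m <;>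
    exact cnEnergies_iff e (hgcd ▸ card_range_δ_twistU) hN (by omega) (by omega)

theorem cnEnergies_SD_iff {n : ℕ} [NeZero n] (hn : 2 ≤ n) :
    (CNEnergiesEqual (SD n) ↔ n = 3) ∧ (CNEnergiesIncreasing (SD n) ↔ ¬ n = 3) := by
  obtain ⟨e⟩ := nonempty_mulEquiv_SD n
  obtain ⟨h2, hgcd⟩ | ⟨h2, hgcd⟩ := gcd_two_eq_one_or_two (n - 1) <;>
    exact cnEnergies_iff e (hgcd ▸ card_range_δ_twistSD) (Nat.card_zmod _) (by omega) (by omega)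

theorem cnEnergies_V_iff {n : ℕ} [NeZero n] (hn : 2 ≤ n) :
    (CNEnergiesEqual (V n) ↔ n = 2) ∧ (CNEnergiesIncreasing (V n) ↔ ¬ n = 2) := by
  obtain ⟨e⟩ := nonempty_mulEquiv_V n
  have hN : Nat.card (ZMod (2 * n) × ZMod 2) = 2 * n * 2 := by
    rw [Nat.card_prod, Nat.card_zmod, Nat.card_zmod]
  have hd : n.lcm 2 = n * 2 / n.gcd 2 := rfl
  obtain ⟨h2, hgcd⟩ | ⟨h2, hgcd⟩ := gcd_two_eq_one_or_two n <;>
    exact cnEnergies_iff e (hgcd ▸ hd ▸ card_range_δ_twistV) hN (by omega) (by omega)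

end GroupFamilies

theorem mainTheorem9 :
    (∀ (n : ℕ) [NeZero n], 3 ≤ n →
      (CNEnergiesEqual (DihedralGroup n) ↔ n = 3 ∨ n = 4 ∨ n = 5 ∨ n = 6) ∧
      (CNEnergiesIncreasing (DihedralGroup n) ↔ ¬ (n = 3 ∨ n = 4 ∨ n = 5 ∨ n = 6))) ∧
    (∀ (n : ℕ) [NeZero n], 2 ≤ n →
      (CNEnergiesEqual (QuaternionGroup n) ↔ n = 2 ∨ n = 3) ∧
      (CNEnergiesIncreasing (QuaternionGroup n) ↔ ¬ (n = 2 ∨ n = 3))) ∧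
    (∀ (n : ℕ) [NeZero n], 2 ≤ n →
      CNEnergiesEqual (GroupFamilies.U6 n) ∧ ¬ CNEnergiesIncreasing (GroupFamilies.U6 n)) ∧
    (∀ (n : ℕ) [NeZero n], 2 ≤ n →
      (CNEnergiesEqual (GroupFamilies.SD n) ↔ n = 3) ∧
      (CNEnergiesIncreasing (GroupFamilies.SD n) ↔ ¬ n = 3)) ∧
    (∀ (n : ℕ) [NeZero n], 2 ≤ n →
      (CNEnergiesEqual (GroupFamilies.V n) ↔ n = 2) ∧
      (CNEnergiesIncreasing (GroupFamilies.V n) ↔ ¬ n = 2)) ∧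
    (∀ (n m : ℕ) [NeZero n] [NeZero m], 2 ≤ n → 3 ≤ m →
      (CNEnergiesEqual (GroupFamilies.U n m) ↔ m = 3 ∨ m = 4 ∨ m = 6) ∧
      (CNEnergiesIncreasing (GroupFamilies.U n m) ↔ ¬ (m = 3 ∨ m = 4 ∨ m = 6))) := by
  open GroupFamilies in
  refine ⟨fun _ _ hn => cnEnergies_dihedralGroup_iff hn,
    fun _ _ hn => cnEnergies_quaternionGroup_iff hn,
    fun _ _ hn => ?_,
    fun _ _ hn => cnEnergies_SD_iff hn,
    fun _ _ hn => cnEnergies_V_iff hn,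
    fun _ _ _ _ hn hm => cnEnergies_U_iff hn hm⟩
  have h := cnEnergies_U_iff hn le_rfl
  exact ⟨h.1.2 (.inl rfl), fun hlt => h.2.1 hlt (.inl rfl)⟩
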